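/- **Setting.** Let $G=(V,E)$ be a locally finite undirected graph (multiple edges and self-loops allowed, $V,E$ possibly infinite), with a specified set $\partial\mathcal G\subset V$ of boundary vertices, edge lengths $\ell_e>0$, edge weights $a_e>0$ and vertex weights $\mathcal V(v)>0$. Let $\mathcal G$ be its geometric realization ($V$ together with an interval of length $\ell_e$ for each edge $e$). For $\Omega\subset\mathcal G$ let $\mathcal V(\Omega)=\sum_{v\in V\cap\Omega}\mathcal V(v)$, let $\mathcal E(e)=a_e\ell_e$, and let $\rho_{\sup}=\sup_{v\in V}\mathcal V(v)^{-1}\sum_{e\ni v}\mathcal E(e)/2$. Write $V^\circ=V\setminus\partial\mathcal G$. An open $\Omega\subset\mathcal G$ is *admissible* if it lies in a union of finitely many vertices and closed edges, its topological boundary $\partial\Omega$ is finite, and $\Omega\cap\partial\mathcal G=\emptyset$. Its boundary area $\mathcal A(\partial\Omega)$ is the sum over $x\in\partial\Omega$ of: $a_e$ if $x$ is interior to the edge $e$; and, if $x$ is a vertex, the sum of $a_e$ over those edges $e$ for which $x$ is in the closure of the part of $\Omega$ interior to $e$. For $\nu>2$ put $$I_\nu=\inf_\Omega \frac{\mathcal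 A(\partial\Omega)}{\mathcal V(\Omega)^{1-1/\nu}},\qquad \widetilde I_\nu=\inf_\Omega \mathcal A(\partial\Omega)\,\min\bigl(\mathcal V(\Omega),\mathcal V(\mathcal G\setminus\Omega)\bigr)^{1/\nu-1},$$ over admissible $\Omega$ with $\mathcal V(\Omega)\neq0$, respectively with $\min(\mathcal V(\Omega),\mathcal V(\mathcal G\setminus\Omega))\ne0$ (an empty infimum is $+\infty$). A function on $\mathcal G$ is *edgewise linear* if it is continuous and affine on each edge; for such $f$, $(\Delta f)(v)=\mathcal V(v)^{-1}\sum_{e\sim\{u,v\}}a_e\,(f(v)-f(u))/\ell_e$. A *fundamental solution* is a function $K:\mathcal G\times\mathcal G\times[0,\infty)\to\mathbb R$, edgewise linear in $x$ and in $y$, with $K(x,y,t)=0$ for $y\in\partial\mathcal G$, such that for each $y\in V^\circ$ the function $u(x,t)=K(x,y,t)$ is continuous on $\mathcal G\times[0,\infty)$, satisfies $u_t=-\Delta u$ on $V^\circ\times(0,\infty)$, $u(x,0)=\delta_y(x)$ for $x\in V^\circ$ (where $\delta_y$ is $1/\mathcal V(y)$ at $y$ and $0$ at the other vertices), and $u(x,t)=0$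 for $x\in\partial\mathcal G$. It is a *heat kernel* if moreover $K(x,y,t)=K(y,x,t)$, $K(x,y,t)=\int K(x,s,\tau)K(s,y,t-\tau)\,d\mathcal V(s)$ for $0\le\tau\le t$, and $K_t(x,y,t)=\int K(x,s,\tau)K_t(s,y,t-\tau)\,d\mathcal V(s)$ for $0\le\tau<t$. The *minimal heat kernel* is the non-negative heat kernel $K$ with $K\le H$ pointwise for every non-negative fundamental solution $H$. **Statement.** $\mathcal G$ has a minimal heat kernel $K$, and for every $\nu>2$, all $x\in\mathcal G$ and all $t>0$, $$K(x,x,t)\le C_2\,t^{-\nu/2},\qquad C_2=(\nu/2)^{\nu/2}C_1^{-\nu},\qquad C_1=I_\nu\,\rho_{\sup}^{-1/2}/2 .$$ If $\mathcal G$ is closed, i.e. $V$ and $E$ are finite and $\partial\mathcal G=\emptyset$, then for every $\nu>2$, all $x\in\mathcal G$ and all $t>0$, $$K(x,x,t)-\frac1{\mathcal V(\mathcal G)}\le C_2\,t^{-\nu/2},\qquad C_2=(\nu/2)^{\nu/2}C_1^{-\nu},\qquad C_1=2^{-2/\nu}\,\widetilde I_\nu\,\rho_{\sup}^{-1/2}/2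 .$$ All constants are computed in $[0,\infty]$ with $0\cdot\infty=0$ in the products forming $C_1$; $C_2=\infty$ when $C_1=0$ (the bound is then void), and $C_2=0$ when $C_1=\infty$. -/

import Mathlib

open Set
open scoped ENNReal

universe u w

/-- An undirected graph (multiple edges and self-loops allowed, `V` and `E` arbitrary) with edge
lengths `ℓ_e`, edge weights `a_e` (the edge measure is `a_e` times Lebesgue measure on `e`), a
vertex measure, and a specified set of boundary vertices. The two endpoints of an edge are listed
in some order `src e`, `tgt e`; this only serves to parametrize the edge, and nothing below
depends on the order. -/
structure CalcGraph (V : Type u) (E : Type w) where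
  src : E → V
  tgt : E → V
  len : E → ℝ
  len_pos : ∀ e, 0 < len e
  weight : E → ℝ
  weight_pos : ∀ e, 0 < weight e
  vmeas : V → ℝ
  vmeas_pos : ∀ v, 0 < vmeas v
  boundary : Set V

namespace CalcGraph

variable {V : Type u} {E : Type w}

/-- The points of the geometric realization: the vertices, and for each edge an open interval of
length `ℓ_e`. -/
inductive Realization (G : CalcGraph V E) : Type (max u w)
  | vertex (v : V) : Realization G
  | inner (e : E) (s : Ioo (0 : ℝ) (G.len e)) : Realization G

/-- The edges having `v` as an endpoint. -/
def incident (G : CalcGraph V E) (v : V) : Set E := {e | G.src e = v ∨ G.tgt e = v}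

/-- Each vertex is incident upon only finitely many edges. -/
def IsLocallyFinite (G : CalcGraph V E) : Prop := ∀ v, (G.incident v).Finite

/-- A closed graph: finite and without boundary. -/
def IsClosedGraph (G : CalcGraph V E) : Prop := Finite V ∧ Finite E ∧ G.boundary = ∅

open Classical in
/-- The closed edge `e`, parametrized by the interval `[0, ℓ_e]` from `src e` to `tgt e`. -/
noncomputable def param (G : CalcGraph V E) (e : E) (s : Icc (0 : ℝ) (G.len e)) :
    G.Realization :=
  if h0 : (s : ℝ) = 0 then .vertex (G.src e)
  else if h1 : (s : ℝ) = G.len e then .vertex (G.tgt e)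
  else .inner e ⟨s, lt_of_le_of_ne s.2.1 (Ne.symm h0), lt_of_le_of_ne s.2.2 h1⟩

/-- The topology of the geometric realization: a set is open iff its trace on every closed edge
is open. On locally finite graphs this is the topology of the path metric. -/
noncomputable instance (G : CalcGraph V E) : TopologicalSpace G.Realization :=
  ⨆ e, TopologicalSpace.coinduced (G.param e) inferInstance

/-- The interior of the edge `e`. -/
def edgeInterior (G : CalcGraph V E) (e : E) : Set G.Realization :=
  range (Realization.inner e)

/-- A set is of finite type if it lies in the union of finitely many vertices and edges. -/
def FiniteType (G : CalcGraph V E) (Ω : Set G.Realization) : Prop :=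
  ∃ (S : Finset V) (T : Finset E),
    Ω ⊆ (Realization.vertex '' (S : Set V)) ∪ ⋃ e ∈ T, range (G.param e)

/-- The vertex measure of a set. -/
noncomputable def vol (G : CalcGraph V E) (Ω : Set G.Realization) : ℝ≥0∞ :=
  ∑' v : {v : V // Realization.vertex v ∈ Ω}, ENNReal.ofReal (G.vmeas v)

/-- The area of a point of `∂Ω`: `a_e` for a point interior to `e`, and for a vertex `v` the sum
of the `a_e` over the edges `e` such that `v` is in the closure of the part of `Ω` interior
to `e`. -/
noncomputable def pointArea (G : CalcGraph V E) (Ω : Set G.Realization) :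
    G.Realization → ℝ≥0∞
  | .inner e _ => ENNReal.ofReal (G.weight e)
  | .vertex v => ∑' e : {e : E // Realization.vertex v ∈ closure (Ω ∩ G.edgeInterior e)},
      ENNReal.ofReal (G.weight e)

/-- `𝒜(∂Ω)`. -/
noncomputable def boundaryArea (G : CalcGraph V E) (Ω : Set G.Realization) : ℝ≥0∞ :=
  ∑' x : frontier Ω, G.pointArea Ω x

/-- Admissible sets: open, of finite type, with finite topological boundary, and disjoint from
the boundary of the graph. -/
def Admissible (G : CalcGraph V E) (Ω : Set G.Realization) : Prop :=
  IsOpen Ω ∧ G.FiniteType Ω ∧ (frontier Ω).Finite ∧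
    ∀ v ∈ G.boundary, Realization.vertex v ∉ Ω

/-- `I_ν = inf 𝒜(∂Ω) / 𝒱(Ω)^{1/ν'}` with `1/ν' = 1 - 1/ν`; the quotient counts as `+∞` when
`𝒱(Ω) = 0`. -/
noncomputable def isoConst (G : CalcGraph V E) (ν : ℝ) : ℝ≥0∞ :=
  ⨅ (Ω : Set G.Realization) (_ : G.Admissible Ω) (_ : G.vol Ω ≠ 0),
    G.boundaryArea Ω / G.vol Ω ^ (1 - 1 / ν)

/-- `Ĩ_ν = inf 𝒜(∂Ω) min(𝒱(Ω), 𝒱(Ωᶜ))^{1/ν - 1}`; the expression counts as `+∞` when the minimum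
is `0`. -/
noncomputable def isoConstClosed (G : CalcGraph V E) (ν : ℝ) : ℝ≥0∞ :=
  ⨅ (Ω : Set G.Realization) (_ : G.Admissible Ω) (_ : min (G.vol Ω) (G.vol Ωᶜ) ≠ 0),
    G.boundaryArea Ω * min (G.vol Ω) (G.vol Ωᶜ) ^ (1 / ν - 1)

/-- The half-degree `ρ(v) = 𝒱(v)⁻¹ ∑_{e ∋ v} ℰ(e)/2`, where `ℰ(e) = a_e ℓ_e`. -/
noncomputable def halfDegree (G : CalcGraph V E) (v : V) : ℝ≥0∞ :=
  (∑' e : G.incident v, ENNReal.ofReal (G.weight e * G.len e / 2)) / ENNReal.ofReal (G.vmeas v)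

/-- `ρ_sup`. -/
noncomputable def rhoSup (G : CalcGraph V E) : ℝ≥0∞ := ⨆ v, G.halfDegree v

/-- Edgewise linear functions: affine along every closed edge. -/
def EdgewiseLinear (G : CalcGraph V E) (f : G.Realization → ℝ) : Prop :=
  ∀ (e : E) (s : Icc (0 : ℝ) (G.len e)),
    f (G.param e s) = (1 - s / G.len e) * f (.vertex (G.src e))
      + (s / G.len e) * f (.vertex (G.tgt e))

open Classical in
/-- The other endpoint of an edge `e` having `v` as an endpoint (`v` itself for a self-loop). -/
noncomputable def otherEnd (G : CalcGraph V E) (e : E) (v : V) : V :=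
  if G.src e = v then G.tgt e else G.src e

/-- The positive semidefinite Laplacian of an edgewise linear function at a vertex,
`(Δf)(v) = 𝒱(v)⁻¹ ∑_{e ∼ {u,v}} a_e (f(v) - f(u)) / ℓ_e`. -/
noncomputable def laplacian (G : CalcGraph V E) (f : G.Realization → ℝ) (v : V) : ℝ :=
  (G.vmeas v)⁻¹ * ∑ᶠ e ∈ G.incident v,
    G.weight e * ((f (.vertex v) - f (.vertex (G.otherEnd e v))) / G.len e)

/-- Solutions `u(x,t)` of the heat equation on `𝒢 × [0,∞)`. -/
structure SolvesHeatEquation (G : CalcGraph V E) (u : G.Realization → ℝ → ℝ) : Prop where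
  continuousOn : ContinuousOn (fun p : G.Realization × ℝ => u p.1 p.2) (univ ×ˢ Ici 0)
  edgewiseLinear : ∀ t, 0 ≤ t → G.EdgewiseLinear fun x => u x t
  heat : ∀ v ∉ G.boundary, ∀ t, 0 < t →
    HasDerivAt (u (.vertex v)) (-G.laplacian (fun x => u x t) v) t

/-- Solutions of the Dirichlet initial value problem with initial value `f` (given on the
interior vertices). -/
structure SolvesDirichletIVP (G : CalcGraph V E) (f : V → ℝ) (u : G.Realization → ℝ → ℝ) :
    Prop extends G.SolvesHeatEquation u where
  initial : ∀ v ∉ G.boundary, u (.vertex v) 0 = f v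
  dirichlet : ∀ v ∈ G.boundary, ∀ t, 0 ≤ t → u (.vertex v) t = 0

open Classical in
/-- `δ_y` on vertices: `1/𝒱(y)` at `y` and `0` elsewhere. -/
noncomputable def delta (G : CalcGraph V E) (y : V) (v : V) : ℝ :=
  if v = y then 1 / G.vmeas y else 0

/-- Fundamental solutions `K(x,y,t)`, `t ≥ 0`, of the heat equation. Values at `t < 0` are
irrelevant here and below. -/
structure IsFundamentalSolution (G : CalcGraph V E)
    (K : G.Realization → G.Realization → ℝ → ℝ) : Prop where
  solves : ∀ y ∉ G.boundary, G.SolvesDirichletIVP (G.delta y) (fun x t => K x (.vertex y) t)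
  boundary_right : ∀ y ∈ G.boundary, ∀ x t, 0 ≤ t → K x (.vertex y) t = 0
  linear_left : ∀ y t, 0 ≤ t → G.EdgewiseLinear fun x => K x y t
  linear_right : ∀ x t, 0 ≤ t → G.EdgewiseLinear fun y => K x y t

/-- Heat kernels: symmetric, self-reproducing fundamental solutions for which the
self-reproducing identity may be differentiated in `t` under the integral. The integral
`∫ f d𝒱` is the sum of `f(v) 𝒱(v)` over the vertices. -/
structure IsHeatKernel (G : CalcGraph V E)
    (K : G.Realization → G.Realization → ℝ → ℝ) : Prop extends G.IsFundamentalSolution K where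
  symm : ∀ x y t, 0 ≤ t → K x y t = K y x t
  selfReproducing : ∀ x y τ t, 0 ≤ τ → τ ≤ t →
    HasSum (fun v : V => K x (.vertex v) τ * K (.vertex v) y (t - τ) * G.vmeas v) (K x y t)
  selfReproducing_deriv : ∀ x y τ t, 0 ≤ τ → τ < t →
    HasSum (fun v : V => K x (.vertex v) τ * deriv (K (.vertex v) y) (t - τ) * G.vmeas v)
      (deriv (K x y) t)

/-- The minimal non-negative heat kernel: a non-negative heat kernel lying below every
non-negative fundamental solution. -/
structure IsMinimalHeatKernel (G : CalcGraph V E)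
    (K : G.Realization → G.Realization → ℝ → ℝ) : Prop extends G.IsHeatKernel K where
  nonneg : ∀ x y t, 0 ≤ t → 0 ≤ K x y t
  minimal : ∀ H : G.Realization → G.Realization → ℝ → ℝ, G.IsFundamentalSolution H →
    (∀ x y t, 0 ≤ t → 0 ≤ H x y t) → ∀ x y t, 0 ≤ t → K x y t ≤ H x y t

/-- `C₁ = I_ν ρ_sup^{-1/2} / 2`. -/
noncomputable def nashC₁ (G : CalcGraph V E) (ν : ℝ) : ℝ≥0∞ :=
  G.isoConst ν * G.rhoSup ^ (-(1 / 2) : ℝ) / 2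

/-- `C₁ = 2^{-2/ν} Ĩ_ν ρ_sup^{-1/2} / 2`, for closed graphs. -/
noncomputable def nashC₁Closed (G : CalcGraph V E) (ν : ℝ) : ℝ≥0∞ :=
  2 ^ (-(2 / ν)) * (G.isoConstClosed ν * G.rhoSup ^ (-(1 / 2) : ℝ) / 2)

end CalcGraph

/-- `C₂ = (ν/2)^{ν/2} C₁^{-ν}`, which is `+∞` when `C₁ = 0` and `0` when `C₁ = +∞`. -/
noncomputable def nashC₂ (ν : ℝ) (C₁ : ℝ≥0∞) : ℝ≥0∞ :=
  ENNReal.ofReal (ν / 2) ^ (ν / 2) * C₁ ^ (-ν)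

/-! Existence. On a finite set `S` of interior vertices, `-Δ` with zero values off `S` is a matrix
`gen G S`, symmetric with respect to `𝒱` and nonnegative off the diagonal. Its exponential gives a
symmetric nonnegative kernel `finKernel`. By comparison (`finKernel_le_of_solution`) this kernel
lies below every nonnegative solution whose value at `y` is initially at least `1/𝒱(y)`, so it
increases with `S` and stays below every nonnegative fundamental solution. The supremum over `S` is
`vKernel`, and its edgewise linear extension in both variables is `minKernel`. Lipschitz and
quadratic bounds uniform in `S` carry the heat equation to the limit. Monotone convergence carries
the semigroup identity, and an `ℓ²` bound on time derivatives carries its differentiated form.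
Minimality makes the kernel unique for `t ≥ 0`, so the bounds need only be shown for `minKernel`.

Decay. This is Nash's argument. A finite vertex set `A` has an open thickening which cuts each edge
leaving `A` at its midpoint, so `I_ν` controls cuts of vertex sets. Slicing a function into level
sets turns this into an `L¹` Sobolev inequality (`isoperimetric_functional`). It is applied to `f²`,
Cauchy–Schwarz with `ρ_sup` brings in the energy, and Hölder interpolation yields `c² ‖f‖₂^{2+4/ν} ≤
energy(f)` for `‖f‖₁ ≤ 1` (`nash_inequality`). For `ψ(t) = K_S(y,y,t) = ‖K_S(·,y,t/2)‖₂²` the energy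
of `K_S(·,y,t/2)` is `-ψ'(t)`; hence `ψ' ≤ -c² ψ^{1+2/ν}`, which integrates to the bound, uniformly
in `S`.

On a closed graph the same is done with `K(·,y,t/2) - 1/𝒱(𝒢)`, which has mean zero and `L¹` norm at
most `2`. Subtracting a median leaves positive and negative parts supported on at most half the
volume, where `Ĩ_ν` applies; the norm `2` produces the factor `2^{-2/ν}`. -/

/-! ### Matrix exponentials of finite Markov generators -/

section MatrixSemigroup

open Matrix NormedSpace Finset

variable {ι : Type*} [Fintype ι] [DecidableEq ι]

/-- The left factor `B` allows repeated differentiation, with `B = 1, A, A * A`. -/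
theorem Matrix.hasDerivAt_exp_smul_apply (A B : Matrix ι ι ℝ) (i j : ι) (t : ℝ) :
    HasDerivAt (fun t : ℝ => (B * exp (t • A)) i j) ((B * A * exp (t • A)) i j) t := by
  have h : HasDerivAt (fun u : ℝ => exp (u • A)) (A * exp (t • A)) t := by
    open scoped Matrix.Norms.Operator in exact hasDerivAt_exp_smul_const' A t
  have h' : ∀ k, HasDerivAt (fun u : ℝ => exp (u • A) k j) ((A * exp (t • A)) k j) t := by
    intro k
    exact (hasDerivAt_pi.1 ((hasDerivAt_pi.1 h) k)) j
  rw [Matrix.mul_assoc, Matrix.mul_apply]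
  simp_rw [Matrix.mul_apply (M := B)]
  exact HasDerivAt.fun_sum fun k _ => (h' k).const_mul (B i k)

theorem Matrix.hasDerivAt_exp_smul_apply' (A : Matrix ι ι ℝ) (i j : ι) (t : ℝ) :
    HasDerivAt (fun t : ℝ => exp (t • A) i j) ((A * exp (t • A)) i j) t := by
  simpa using Matrix.hasDerivAt_exp_smul_apply A 1 i j t

theorem Matrix.exp_add_smul (A : Matrix ι ι ℝ) (s t : ℝ) :
    exp ((s + t) • A) = exp (s • A) * exp (t • A) := by
  rw [add_smul]
  exact Matrix.exp_add_of_commute _ _ (((Commute.refl A).smul_left s).smul_right t)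

theorem Matrix.commute_exp_smul (A : Matrix ι ι ℝ) (t : ℝ) : Commute A (exp (t • A)) := by
  open scoped Matrix.Norms.Operator in
  exact ((Commute.refl A).smul_right t).exp_right

theorem Matrix.exp_apply_nonneg_of_nonneg (A : Matrix ι ι ℝ) (hA : ∀ i j, 0 ≤ A i j) (i j : ι) :
    0 ≤ exp A i j := by
  have hp : ∀ n : ℕ, ∀ i j, 0 ≤ (A ^ n) i j := by
    intro n
    induction n with
    | zero => intro i j; rw [pow_zero, Matrix.one_apply]; split_ifs <;> norm_num
    | succ n ih =>
      intro i j
      rw [pow_succ, Matrix.mul_apply]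
      exact Finset.sum_nonneg fun k _ => mul_nonneg (ih i k) (hA k j)
  have h : HasSum (fun n : ℕ => ((n.factorial : ℝ)⁻¹) • A ^ n) (exp A) := by
    open scoped Matrix.Norms.Operator in exact exp_series_hasSum_exp' (𝕂 := ℝ) A
  have h2 : HasSum (fun n : ℕ => (((n.factorial : ℝ)⁻¹) • A ^ n) i j) (exp A i j) :=
    Pi.hasSum.1 (Pi.hasSum.1 h i) j
  refine h2.nonneg fun n => ?_
  rw [Matrix.smul_apply, smul_eq_mul]
  exact mul_nonneg (by positivity) (hp n i j)

/-- Matrices with nonnegative off-diagonal entries generate positivity preserving semigroups. -/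
theorem Matrix.exp_smul_apply_nonneg (A : Matrix ι ι ℝ) (hA : ∀ i j, i ≠ j → 0 ≤ A i j)
    {t : ℝ} (ht : 0 ≤ t) (i j : ι) : 0 ≤ exp (t • A) i j := by
  -- Adding a multiple of the identity makes every entry nonnegative; it commutes with `A` and
  -- changes the exponential only by a positive scalar.
  obtain ⟨c, hc⟩ : ∃ c : ℝ, ∀ i, 0 ≤ A i i + c := by
    refine ⟨∑ i, |A i i|, fun i => ?_⟩
    have := Finset.single_le_sum (f := fun i => |A i i|) (fun _ _ => abs_nonneg _) (mem_univ i)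
    have h2 := neg_abs_le (A i i)
    have h3 : |A i i| ≤ ∑ i, |A i i| := this
    linarith
  have hB : ∀ i j, 0 ≤ (A + c • (1 : Matrix ι ι ℝ)) i j := by
    intro i j
    by_cases h : i = j
    · subst h; simpa using hc i
    · simpa [Matrix.one_apply, h] using hA i j h
  have hsum : t • A = (-(t * c)) • (1 : Matrix ι ι ℝ) + t • (A + c • (1 : Matrix ι ι ℝ)) := by
    rw [smul_add, smul_smul, neg_smul]; abel
  have hdiag : exp ((-(t * c)) • (1 : Matrix ι ι ℝ)) =
      Matrix.diagonal fun _ => Real.exp (-(t * c)) := by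
    have : (-(t * c)) • (1 : Matrix ι ι ℝ) = Matrix.diagonal fun _ => -(t * c) := by
      ext a b; simp [Matrix.one_apply, Matrix.diagonal_apply]
    rw [this, Matrix.exp_diagonal]
    congr 1
    ext a
    rw [Pi.exp_def, Real.exp_eq_exp_ℝ]
  rw [hsum, Matrix.exp_add_of_commute _ _ ((Commute.one_left _).smul_left _), hdiag,
    Matrix.diagonal_mul]
  refine mul_nonneg (Real.exp_nonneg _) (Matrix.exp_apply_nonneg_of_nonneg _ (fun i j => ?_) i j)
  exact mul_nonneg ht (hB i j)

/-- Comparison with supersolutions of `w' = A w`. -/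
theorem Matrix.exp_smul_mulVec_le (A : Matrix ι ι ℝ) (hA : ∀ i j, i ≠ j → 0 ≤ A i j)
    (w d : ι → ℝ → ℝ) (hc : ∀ i, ContinuousOn (w i) (Ici 0))
    (hd : ∀ i t, 0 < t → HasDerivAt (w i) (d i t) t)
    (hle : ∀ i t, 0 < t → ∑ j, A i j * w j t ≤ d i t) {t : ℝ} (ht : 0 ≤ t) (i : ι) :
    ∑ j, exp (t • A) i j * w j 0 ≤ w i t := by
  -- Duhamel interpolation: `F` runs from `exp (t • A) w(0)` to `w(t)`, with derivative `exp ((t -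
  -- s) • A) (d - A w) ≥ 0`.
  let F : ℝ → ℝ := fun s => ∑ j, exp ((t - s) • A) i j * w j s
  have hder : ∀ j s, HasDerivAt (fun s => exp ((t - s) • A) i j)
      (-((exp ((t - s) • A) * A) i j)) s := by
    intro j s
    have h1 := Matrix.hasDerivAt_exp_smul_apply' A i j (t - s)
    have h2 : HasDerivAt (fun s : ℝ => t - s) (-1) s := by
      simpa using (hasDerivAt_id s).const_sub t
    have := h1.comp s h2
    rw [(Matrix.commute_exp_smul A (t - s)).eq] at this
    simpa [Function.comp_def] using this
  have hF : MonotoneOn F (Icc 0 t) := by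
    have hFd : ∀ s, 0 < s → HasDerivAt F (∑ j, (-((exp ((t - s) • A) * A) i j) * w j s +
        exp ((t - s) • A) i j * d j s)) s := fun s hs =>
      HasDerivAt.fun_sum fun j _ => (hder j s).mul (hd j s hs)
    refine monotoneOn_of_deriv_nonneg (convex_Icc 0 t) ?_ ?_ ?_
    · refine continuousOn_finsetSum _ fun j _ => ContinuousOn.mul ?_ ((hc j).mono Icc_subset_Ici_self)
      exact fun s _ => (hder j s).continuousAt.continuousWithinAt
    · rw [interior_Icc]
      exact fun s hs => (hFd s hs.1).differentiableAt.differentiableWithinAt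
    · rw [interior_Icc]
      intro s hs
      rw [(hFd s hs.1).deriv, Finset.sum_add_distrib]
      have h1 : ∑ j, -((exp ((t - s) • A) * A) i j) * w j s =
          -∑ k, exp ((t - s) • A) i k * ∑ j, A k j * w j s := by
        simp_rw [Matrix.mul_apply, neg_mul, Finset.sum_neg_distrib, Finset.sum_mul, Finset.mul_sum]
        rw [Finset.sum_comm]
        simp_rw [mul_assoc]
      rw [h1, neg_add_eq_sub, sub_nonneg]
      refine Finset.sum_le_sum fun k _ => mul_le_mul_of_nonneg_left (hle k s hs.1) ?_
      exact Matrix.exp_smul_apply_nonneg A hA (sub_nonneg.2 hs.2.le) i k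
  have := hF ⟨le_rfl, ht⟩ ⟨ht, le_rfl⟩ ht
  simpa [F, Matrix.one_apply] using this

variable (m : ι → ℝ) (hm : ∀ i, 0 < m i) (A : Matrix ι ι ℝ)
  (hs : ∀ i j, m i * A i j = m j * A j i)

include hm hs in
-- Conjugation by `diagonal m` takes `A` to its transpose, and `exp` commutes with conjugation and
-- transposition.
theorem Matrix.exp_smul_symm (t : ℝ) (i j : ι) :
    m i * exp (t • A) i j = m j * exp (t • A) j i := by
  have hU : IsUnit (Matrix.diagonal m) := by
    rw [Matrix.isUnit_iff_isUnit_det, Matrix.det_diagonal]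
    exact (Finset.prod_ne_zero_iff.2 fun i _ => (hm i).ne').isUnit
  have hU' : IsUnit (Matrix.diagonal m).det := (Matrix.isUnit_iff_isUnit_det _).1 hU
  have h0 : Matrix.diagonal m * A = Aᵀ * Matrix.diagonal m := by
    ext a b
    rw [Matrix.diagonal_mul, Matrix.mul_diagonal, Matrix.transpose_apply, hs, mul_comm]
  have h1 : Matrix.diagonal m * (t • A) * (Matrix.diagonal m)⁻¹ = (t • A)ᵀ := by
    rw [Matrix.mul_smul, h0, Matrix.transpose_smul, Matrix.smul_mul, Matrix.mul_assoc,
      Matrix.mul_nonsing_inv _ hU', Matrix.mul_one]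
  have h2 := Matrix.exp_conj (Matrix.diagonal m) (t • A) hU
  rw [h1, Matrix.exp_transpose] at h2
  have h3 : (exp (t • A))ᵀ * Matrix.diagonal m = Matrix.diagonal m * exp (t • A) := by
    rw [h2, Matrix.mul_assoc, Matrix.nonsing_inv_mul _ hU', Matrix.mul_one]
  have := congrFun (congrFun h3 i) j
  rw [Matrix.mul_diagonal, Matrix.diagonal_mul, Matrix.transpose_apply] at this
  rw [← this, mul_comm]

include hm hs in
theorem Matrix.mul_exp_smul_symm (t : ℝ) (i j : ι) :
    m i * (A * exp (t • A)) i j = m j * (A * exp (t • A)) j i := by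
  have h : (A * exp (t • A)) i j = ∑ k, exp (t • A) i k * A k j := by
    rw [(Matrix.commute_exp_smul A t).eq, Matrix.mul_apply]
  rw [h, Matrix.mul_apply, Finset.mul_sum, Finset.mul_sum]
  refine Finset.sum_congr rfl fun k _ => ?_
  rw [← mul_assoc, Matrix.exp_smul_symm m hm A hs, mul_right_comm, hs]
  ring

omit [DecidableEq ι] in
theorem Matrix.mul_mul_diag_of_symm (M N : Matrix ι ι ℝ) (hM : ∀ i j, m i * M i j = m j * M j i)
    (y : ι) : m y * (M * N) y y = ∑ v, m v * (M v y * N v y) := by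
  rw [Matrix.mul_apply, Finset.mul_sum]
  exact Finset.sum_congr rfl fun v _ => by rw [← mul_assoc, hM, mul_assoc]

/-- Taylor's formula based at `t`: `f 0 = f t - t f1(t) + ∫₀ᵗ s f2(s) ds`, where the first two terms
are nonnegative and the integral is at least `f2(t) t²/2`. -/
theorem mul_sq_le_of_antitone_deriv2 {f f1 f2 : ℝ → ℝ} (hf : ∀ t, HasDerivAt f (f1 t) t)
    (hf1 : ∀ t, HasDerivAt f1 (f2 t) t) (h0 : ∀ t, 0 ≤ f t) (h1 : ∀ t, f1 t ≤ 0)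
    (h2 : Antitone f2) {t : ℝ} (ht : 0 ≤ t) : f2 t * t ^ 2 ≤ 2 * f 0 := by
  have hG : MonotoneOn (fun s => f1 s - f2 t * s) (Icc 0 t) := by
    have hd : ∀ s, HasDerivAt (fun s => f1 s - f2 t * s) (f2 s - f2 t) s := fun s => by
      simpa using (hf1 s).fun_sub ((hasDerivAt_id' s).const_mul (f2 t))
    refine monotoneOn_of_deriv_nonneg (convex_Icc 0 t)
      (fun s _ => (hd s).continuousAt.continuousWithinAt)
      (fun s _ => (hd s).differentiableAt.differentiableWithinAt) ?_
    rw [interior_Icc]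
    intro s hs
    rw [(hd s).deriv]
    exact sub_nonneg.2 (h2 hs.2.le)
  have hF : AntitoneOn (fun s => f s - f2 t * (t - s) ^ 2 / 2) (Icc 0 t) := by
    have hd : ∀ s, HasDerivAt (fun s => f s - f2 t * (t - s) ^ 2 / 2)
        (f1 s + f2 t * (t - s)) s := fun s => by
      have := (hf s).sub ((((hasDerivAt_id s).const_sub t).pow 2).const_mul (f2 t) |>.div_const 2)
      refine this.congr_deriv ?_
      simp
      ring
    refine antitoneOn_of_deriv_nonpos (convex_Icc 0 t)
      (fun s _ => (hd s).continuousAt.continuousWithinAt)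
      (fun s _ => (hd s).differentiableAt.differentiableWithinAt) ?_
    rw [interior_Icc]
    intro s hs
    rw [(hd s).deriv]
    have := hG ⟨hs.1.le, hs.2.le⟩ ⟨ht, le_rfl⟩ hs.2.le
    simp only at this
    linarith [h1 t]
  have := hF ⟨le_rfl, ht⟩ ⟨ht, le_rfl⟩ ht
  simp only at this
  nlinarith [h0 t]

include hm hs in
/-- Time derivatives of a symmetric Markov semigroup are bounded in `ℓ²`. -/
theorem Matrix.sum_sq_mul_exp_smul_le
    (hneg : ∀ f : ι → ℝ, ∑ i, m i * (f i * ∑ j, A i j * f j) ≤ 0) {t : ℝ} (ht : 0 ≤ t) (y : ι) :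
    (∑ v, m v * (A * exp (t • A)) v y ^ 2) * (2 * t ^ 2) ≤ m y := by
  let P : ℝ → Matrix ι ι ℝ := fun r => exp (r • A)
  have hP : ∀ r, P r = P (r / 2) * P (r / 2) := fun r => by
    rw [← Matrix.exp_add_smul, add_halves]
  have hcomm : ∀ r, A * P r = P r * A := fun r => (Matrix.commute_exp_smul A r).eq
  have hcomm' : ∀ r X, P r * (A * X) = A * (P r * X) := fun r X => by
    rw [← Matrix.mul_assoc, ← hcomm, Matrix.mul_assoc]
  have hf : ∀ r, HasDerivAt (fun r => P r y y) ((A * P r) y y) r := fun r =>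
    Matrix.hasDerivAt_exp_smul_apply' A y y r
  have hf1 : ∀ r, HasDerivAt (fun r => (A * P r) y y) ((A * A * P r) y y) r := fun r =>
    Matrix.hasDerivAt_exp_smul_apply A A y y r
  have hf2 : ∀ r, HasDerivAt (fun r => (A * A * P r) y y) ((A * A * A * P r) y y) r := fun r =>
    Matrix.hasDerivAt_exp_smul_apply A (A * A) y y r
  -- Splitting time in halves writes each diagonal derivative as a quadratic form: squares for even
  -- order, the form of `A` for odd order. This gives the signs needed for the Taylor estimate.
  have e0 : ∀ r, m y * P r y y = ∑ v, m v * (P (r / 2) v y * P (r / 2) v y) := fun r => by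
    rw [hP r]
    exact Matrix.mul_mul_diag_of_symm m _ _ (Matrix.exp_smul_symm m hm A hs _) y
  have e1 : ∀ r, m y * (A * P r) y y =
      ∑ v, m v * (P (r / 2) v y * ∑ w, A v w * P (r / 2) w y) := fun r => by
    have : A * P r = P (r / 2) * (A * P (r / 2)) := by
      rw [hP r, hcomm']
    rw [this]
    exact Matrix.mul_mul_diag_of_symm m _ _ (Matrix.exp_smul_symm m hm A hs _) y
  have e2 : ∀ r, m y * (A * A * P r) y y =
      ∑ v, m v * ((A * P (r / 2)) v y * (A * P (r / 2)) v y) := fun r => by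
    have : A * A * P r = (A * P (r / 2)) * (A * P (r / 2)) := by
      rw [hP r]
      simp only [Matrix.mul_assoc, hcomm']
    rw [this]
    exact Matrix.mul_mul_diag_of_symm m _ _ (Matrix.mul_exp_smul_symm m hm A hs _) y
  have e3 : ∀ r, m y * (A * A * A * P r) y y =
      ∑ v, m v * ((A * P (r / 2)) v y * ∑ w, A v w * (A * P (r / 2)) w y) := fun r => by
    have : A * A * A * P r = (A * P (r / 2)) * (A * (A * P (r / 2))) := by
      rw [hP r]
      simp only [Matrix.mul_assoc, hcomm']
    rw [this]
    exact Matrix.mul_mul_diag_of_symm m _ _ (Matrix.mul_exp_smul_symm m hm A hs _) y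
  have p0 : ∀ r, 0 ≤ P r y y := fun r => nonneg_of_mul_nonneg_right
    (by rw [e0]; exact Finset.sum_nonneg fun v _ => mul_nonneg (hm v).le (mul_self_nonneg _)) (hm y)
  have p1 : ∀ r, (A * P r) y y ≤ 0 := fun r =>
    nonpos_of_mul_nonpos_right (by rw [e1]; exact hneg _) (hm y)
  have p3 : ∀ r, (A * A * A * P r) y y ≤ 0 := fun r =>
    nonpos_of_mul_nonpos_right (by rw [e3]; exact hneg _) (hm y)
  have anti : Antitone fun r => (A * A * P r) y y :=
    antitone_of_deriv_nonpos (fun r => (hf2 r).differentiableAt) fun r => by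
      rw [(hf2 r).deriv]; exact p3 r
  -- Time `2t` is used because its half is the `t` of the claim.
  have key := mul_sq_le_of_antitone_deriv2 hf hf1 p0 p1 anti (t := 2 * t) (by positivity)
  have e2' := e2 (2 * t)
  rw [mul_div_cancel_left₀ t two_ne_zero] at e2'
  have hone : P 0 y y = 1 := by simp [P]
  rw [hone] at key
  simp_rw [pow_two ((A * exp (t • A)) _ y)]
  rw [← e2']
  nlinarith [hm y]

end MatrixSemigroup

namespace CalcGraph

variable {V : Type u} {E : Type w} (G : CalcGraph V E)

/-! ### The Laplacian on functions on vertices -/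

/-- The Laplacian of a function on the vertices. -/
noncomputable def lap (f : V → ℝ) (v : V) : ℝ :=
  (G.vmeas v)⁻¹ * ∑ᶠ e ∈ G.incident v, G.weight e * ((f v - f (G.otherEnd e v)) / G.len e)

variable {G} (hG : G.IsLocallyFinite)

include hG in
theorem lap_eq_sum (f : V → ℝ) (v : V) : G.lap f v = (G.vmeas v)⁻¹ *
    ∑ e ∈ (hG v).toFinset, G.weight e / G.len e * (f v - f (G.otherEnd e v)) := by
  rw [lap, finsum_mem_eq_finite_toFinset_sum _ (hG v)]
  congr 1
  exact Finset.sum_congr rfl fun e _ => by ring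

include hG in
theorem lap_sub (f g : V → ℝ) (v : V) :
    G.lap (fun u => f u - g u) v = G.lap f v - G.lap g v := by
  simp only [lap_eq_sum hG]
  rw [← mul_sub, ← Finset.sum_sub_distrib]
  congr 1
  exact Finset.sum_congr rfl fun e _ => by ring

include hG in
theorem lap_sum {ι : Type*} (s : Finset ι) (c : ι → ℝ) (f : ι → V → ℝ) (v : V) :
    G.lap (fun u => ∑ i ∈ s, c i * f i u) v = ∑ i ∈ s, c i * G.lap (f i) v := by
  simp only [lap_eq_sum hG, Finset.mul_sum]
  rw [Finset.sum_comm]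
  refine Finset.sum_congr rfl fun e _ => ?_
  rw [← Finset.sum_sub_distrib, Finset.mul_sum, Finset.mul_sum]
  exact Finset.sum_congr rfl fun i _ => by ring

theorem lap_const (c : ℝ) (v : V) : G.lap (fun _ => c) v = 0 := by
  simp [lap]

/-- The edges having an endpoint in `S`. -/
noncomputable def edgesOf (hG : G.IsLocallyFinite) (S : Finset V) : Finset E :=
  (S.finite_toSet.biUnion fun v _ => hG v).toFinset

theorem mem_edgesOf {S : Finset V} {e : E} :
    e ∈ edgesOf hG S ↔ G.src e ∈ S ∨ G.tgt e ∈ S := by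
  simp only [edgesOf, Finite.mem_toFinset, mem_iUnion, incident, mem_ofPred_eq, exists_prop,
    Finset.mem_coe]
  constructor
  · rintro ⟨v, hv, rfl | rfl⟩
    exacts [Or.inl hv, Or.inr hv]
  · rintro (h | h)
    exacts [⟨_, h, Or.inl rfl⟩, ⟨_, h, Or.inr rfl⟩]

open Classical in
-- The edge set does not depend on `v`, so sums over vertices and edges can be exchanged. At a
-- self-loop both indicators fire and both differences vanish.
theorem vmeas_mul_lap {S : Finset V} (f : V → ℝ) {v : V} (hv : v ∈ S) :
    G.vmeas v * G.lap f v = ∑ e ∈ edgesOf hG S, G.weight e / G.len e *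
      ((if G.src e = v then f (G.src e) - f (G.tgt e) else 0) +
        if G.tgt e = v then f (G.tgt e) - f (G.src e) else 0) := by
  rw [lap_eq_sum hG, mul_inv_cancel_left₀ (G.vmeas_pos v).ne']
  have hsub : (hG v).toFinset ⊆ edgesOf hG S := by
    intro e he
    rw [Finite.mem_toFinset] at he
    rw [mem_edgesOf]
    rcases he with rfl | rfl
    exacts [Or.inl hv, Or.inr hv]
  rw [← Finset.sum_subset hsub]
  · refine Finset.sum_congr rfl fun e he => ?_
    rw [Finite.mem_toFinset] at he
    congr 1
    unfold otherEnd
    rcases he with h | h <;> by_cases h1 : G.src e = v <;> by_cases h2 : G.tgt e = v <;>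
      simp_all
  · intro e _ he
    rw [Finite.mem_toFinset] at he
    have h1 : G.src e ≠ v := fun h => he (Or.inl h)
    have h2 : G.tgt e ≠ v := fun h => he (Or.inr h)
    simp [h1, h2]

/-- Green's formula. -/
theorem sum_mul_lap (S : Finset V) (f g : V → ℝ) (hg : ∀ v ∉ S, g v = 0) :
    ∑ v ∈ S, G.vmeas v * (g v * G.lap f v) = ∑ e ∈ edgesOf hG S, G.weight e / G.len e *
      ((f (G.src e) - f (G.tgt e)) * (g (G.src e) - g (G.tgt e))) := by
  classical
  have h1 : ∀ v ∈ S, G.vmeas v * (g v * G.lap f v) = ∑ e ∈ edgesOf hG S, g v *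
      (G.weight e / G.len e *
      ((if G.src e = v then f (G.src e) - f (G.tgt e) else 0) +
        if G.tgt e = v then f (G.tgt e) - f (G.src e) else 0)) := by
    intro v hv
    rw [mul_left_comm, vmeas_mul_lap hG f hv, Finset.mul_sum]
  have key : ∀ (x : V) (c : ℝ), ∑ v ∈ S, g v * (if x = v then c else 0) = g x * c := by
    intro x c
    simp only [mul_ite, mul_zero, Finset.sum_ite_eq]
    split_ifs with h
    · rfl
    · rw [hg x h, zero_mul]
  rw [Finset.sum_congr rfl h1, Finset.sum_comm]
  refine Finset.sum_congr rfl fun e _ => ?_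
  have h2 : ∀ v, g v * (G.weight e / G.len e *
      ((if G.src e = v then f (G.src e) - f (G.tgt e) else 0) +
        if G.tgt e = v then f (G.tgt e) - f (G.src e) else 0)) =
      G.weight e / G.len e * (g v * (if G.src e = v then f (G.src e) - f (G.tgt e) else 0) +
        g v * if G.tgt e = v then f (G.tgt e) - f (G.src e) else 0) := fun v => by ring
  simp_rw [h2]
  rw [← Finset.mul_sum, Finset.sum_add_distrib, key, key]
  ring

theorem coeff_pos (G : CalcGraph V E) (e : E) : 0 < G.weight e / G.len e :=
  div_pos (G.weight_pos e) (G.len_pos e)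

include hG in
theorem lap_le_lap {f g : V → ℝ} {v : V} (hv : f v = g v) (h : ∀ u, g u ≤ f u) :
    G.lap f v ≤ G.lap g v := by
  rw [lap_eq_sum hG, lap_eq_sum hG, hv]
  refine mul_le_mul_of_nonneg_left (Finset.sum_le_sum fun e _ => ?_)
    (inv_nonneg.2 (G.vmeas_pos v).le)
  exact mul_le_mul_of_nonneg_left (by linarith [h (G.otherEnd e v)]) (coeff_pos G e).le

/-! ### Dirichlet heat kernels of finite sets of vertices -/

open Classical in
/-- The generator `-Δ` with Dirichlet conditions off `S`. -/
noncomputable def gen (G : CalcGraph V E) (S : Finset V) : Matrix S S ℝ :=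
  fun u v => -G.lap (Pi.single (v : V) 1) u

include hG in
theorem sum_gen_mul (S : Finset V) (f : V → ℝ) (u : S) :
    ∑ v : S, G.gen S u v * f v = -G.lap ((S : Set V).indicator f) u := by
  classical
  have : (S : Set V).indicator f = fun x => ∑ v ∈ S, f v * Pi.single (M := fun _ => ℝ) v 1 x := by
    ext x
    simp [Pi.single_apply, indicator_apply]
  rw [this, lap_sum hG, ← Finset.sum_neg_distrib]
  refine (Finset.sum_coe_sort S fun v => -G.lap (Pi.single v 1) u * f v).trans ?_
  exact Finset.sum_congr rfl fun v _ => by ring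

include hG in
theorem gen_nonneg (S : Finset V) (u v : S) (h : u ≠ v) : 0 ≤ G.gen S u v := by
  classical
  have h' : (u : V) ≠ v := fun h' => h (Subtype.ext h')
  rw [gen, lap_eq_sum hG, ← mul_neg, ← Finset.sum_neg_distrib]
  refine mul_nonneg (inv_nonneg.2 (G.vmeas_pos u).le) (Finset.sum_nonneg fun e _ => ?_)
  rw [← mul_neg]
  refine mul_nonneg (coeff_pos G e).le ?_
  rw [Pi.single_eq_of_ne h', zero_sub, neg_neg, Pi.single_apply]
  split_ifs <;> norm_num

include hG in
theorem gen_symm (S : Finset V) (u v : S) :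
    G.vmeas u * G.gen S u v = G.vmeas v * G.gen S v u := by
  classical
  have key : ∀ u v : S, G.vmeas u * G.gen S u v = -∑ e ∈ edgesOf hG S, G.weight e / G.len e *
      ((Pi.single (M := fun _ => ℝ) (v : V) 1 (G.src e) -
        Pi.single (M := fun _ => ℝ) (v : V) 1 (G.tgt e)) *
      (Pi.single (M := fun _ => ℝ) (u : V) 1 (G.src e) -
        Pi.single (M := fun _ => ℝ) (u : V) 1 (G.tgt e))) := by
    intro u v
    rw [← sum_mul_lap hG S]
    · rw [Finset.sum_eq_single_of_mem (u : V) u.2]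
      · simp [gen]
      · intro b _ hb
        simp [Pi.single_eq_of_ne hb]
    · intro x hx
      exact Pi.single_eq_of_ne (fun h : x = u => hx (h.symm ▸ u.2)) _
  rw [key, key]
  congr 1
  exact Finset.sum_congr rfl fun e _ => by ring

include hG in
theorem gen_nonpos (S : Finset V) (f : S → ℝ) :
    ∑ u : S, G.vmeas u * (f u * ∑ v : S, G.gen S u v * f v) ≤ 0 := by
  classical
  let g : V → ℝ := fun v => if h : v ∈ S then f ⟨v, h⟩ else 0
  have hg : ∀ v : S, f v = g v := fun v => by simp [g]
  have hg0 : ∀ v ∉ S, g v = 0 := fun v hv => by simp [g, hv]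
  have hi : (S : Set V).indicator g = g := by
    rw [indicator_eq_self]
    intro v hv
    by_contra h
    exact hv (hg0 v h)
  simp_rw [hg, sum_gen_mul hG S g, hi]
  rw [Finset.sum_coe_sort S fun u => G.vmeas u * (g u * -G.lap g u)]
  simp_rw [mul_neg]
  rw [Finset.sum_neg_distrib, sum_mul_lap hG S g g hg0, neg_nonpos]
  exact Finset.sum_nonneg fun e _ => mul_nonneg (coeff_pos G e).le (mul_self_nonneg _)

open Classical in
/-- The Dirichlet heat kernel of a finite set of vertices. -/
noncomputable def finKernel (G : CalcGraph V E) (S : Finset V) (u v : V) (t : ℝ) : ℝ :=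
  if h : u ∈ S ∧ v ∈ S then NormedSpace.exp (t • G.gen S) ⟨u, h.1⟩ ⟨v, h.2⟩ / G.vmeas v else 0

variable {S : Finset V}

open Classical in
theorem finKernel_coe (u v : S) (t : ℝ) :
    G.finKernel S u v t = NormedSpace.exp (t • G.gen S) u v / G.vmeas v := by
  rw [finKernel, dif_pos ⟨u.2, v.2⟩]

theorem finKernel_of_left {u : V} (hu : u ∉ S) (v : V) (t : ℝ) : G.finKernel S u v t = 0 :=
  dif_neg fun h => hu h.1

theorem finKernel_of_right (u : V) {v : V} (hv : v ∉ S) (t : ℝ) : G.finKernel S u v t = 0 :=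
  dif_neg fun h => hv h.2

include hG in
theorem finKernel_nonneg (u v : V) {t : ℝ} (ht : 0 ≤ t) : 0 ≤ G.finKernel S u v t := by
  classical
  unfold finKernel
  split_ifs with h
  · exact div_nonneg (Matrix.exp_smul_apply_nonneg _ (gen_nonneg hG S) ht _ _) (G.vmeas_pos v).le
  · rfl

include hG in
theorem finKernel_symm (u v : V) (t : ℝ) : G.finKernel S u v t = G.finKernel S v u t := by
  classical
  by_cases hu : u ∈ S
  · by_cases hv : v ∈ S
    · lift u to S using hu
      lift v to S using hv
      rw [finKernel_coe, finKernel_coe, div_eq_div_iff (G.vmeas_pos v).ne' (G.vmeas_pos u).ne']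
      have := Matrix.exp_smul_symm (fun v : S => G.vmeas v) (fun v => G.vmeas_pos v) (G.gen S)
        (gen_symm hG S) t u v
      linarith
    · rw [finKernel_of_left hv, finKernel_of_right _ hv]
  · rw [finKernel_of_left hu, finKernel_of_right _ hu]

open Classical in
theorem finKernel_zero (u v : V) :
    G.finKernel S u v 0 = if u ∈ S ∧ u = v then 1 / G.vmeas v else 0 := by
  by_cases hu : u ∈ S
  · by_cases hv : v ∈ S
    · lift u to S using hu
      lift v to S using hv
      rw [finKernel_coe]
      simp only [zero_smul, NormedSpace.exp_zero, Matrix.one_apply, Subtype.ext_iff]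
      simp [ite_div]
    · rw [finKernel_of_right _ hv, if_neg]
      rintro ⟨h, rfl⟩
      exact hv h
  · rw [finKernel_of_left hu, if_neg fun h => hu h.1]

theorem finKernel_eq_indicator (v : V) (t : ℝ) : (S : Set V).indicator (fun w => G.finKernel S w v t)
    = fun w => G.finKernel S w v t := by
  rw [indicator_eq_self]
  intro x hx
  by_contra h
  exact hx (finKernel_of_left h v t)

include hG in
open Classical in
theorem neg_lap_finKernel (u v : S) (t : ℝ) : -G.lap (fun w => G.finKernel S w v t) u =
    (G.gen S * NormedSpace.exp (t • G.gen S)) u v / G.vmeas v := by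
  rw [← finKernel_eq_indicator, ← sum_gen_mul hG, Matrix.mul_apply, Finset.sum_div]
  exact Finset.sum_congr rfl fun w _ => by rw [finKernel_coe, mul_div_assoc]

include hG in
theorem hasDerivAt_finKernel {u : V} (hu : u ∈ S) (v : V) (t : ℝ) :
    HasDerivAt (G.finKernel S u v) (-G.lap (fun w => G.finKernel S w v t) u) t := by
  classical
  by_cases hv : v ∈ S
  · lift u to S using hu
    lift v to S using hv
    rw [neg_lap_finKernel hG]
    have := (Matrix.hasDerivAt_exp_smul_apply' (G.gen S) u v t).div_const (G.vmeas v)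
    exact this.congr_of_eventuallyEq (.of_forall fun t => finKernel_coe u v t)
  · have h : ∀ w t, G.finKernel S w v t = 0 := fun w t => finKernel_of_right w hv t
    have h2 : G.finKernel S u v = fun _ => 0 := funext (h u)
    simp_rw [h, h2, lap_const, neg_zero]
    exact hasDerivAt_const _ _

theorem finKernel_add (u v : V) (s t : ℝ) : G.finKernel S u v (s + t) =
    ∑ w ∈ S, G.finKernel S u w s * G.finKernel S w v t * G.vmeas w := by
  classical
  by_cases hu : u ∈ S
  · by_cases hv : v ∈ S
    · lift u to S using hu
      lift v to S using hv
      rw [finKernel_coe, Matrix.exp_add_smul, Matrix.mul_apply, Finset.sum_div,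
        ← Finset.sum_coe_sort S fun w => G.finKernel S u w s * G.finKernel S w v t * G.vmeas w]
      refine Finset.sum_congr rfl fun w _ => ?_
      rw [finKernel_coe, finKernel_coe]
      have := (G.vmeas_pos w).ne'
      field_simp
    · simp [finKernel_of_right _ hv]
  · simp [finKernel_of_left hu]

include hG in
-- Both sides come from differentiating the semigroup identity in its second time variable.
theorem lap_finKernel_add {u : V} (hu : u ∈ S) (v : V) (s t : ℝ) :
    G.lap (fun w => G.finKernel S w v (s + t)) u =
      ∑ w ∈ S, G.finKernel S u w s * G.lap (fun x => G.finKernel S x v t) w * G.vmeas w := by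
  have h1 : HasDerivAt (fun t => G.finKernel S u v (s + t))
      (-G.lap (fun w => G.finKernel S w v (s + t)) u) t :=
    (hasDerivAt_finKernel hG hu v (s + t)).comp_const_add s t
  have h2 : HasDerivAt (fun t => G.finKernel S u v (s + t))
      (∑ w ∈ S, G.finKernel S u w s * -G.lap (fun x => G.finKernel S x v t) w * G.vmeas w) t := by
    simp_rw [finKernel_add]
    exact HasDerivAt.fun_sum fun w hw =>
      ((hasDerivAt_finKernel hG hw v t).const_mul _).mul_const _
  have := h1.unique h2
  simp_rw [mul_neg, neg_mul, Finset.sum_neg_distrib] at this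
  exact neg_injective this

include hG in
-- On `S` the Laplacian is minus the time derivative. The bound does not depend on `S`, which later
-- controls tails uniformly in the exhaustion.
theorem sum_sq_lap_finKernel_le (y : V) {t : ℝ} (ht : 0 < t) :
    ∑ v ∈ S, G.vmeas v * G.lap (fun w => G.finKernel S w y t) v ^ 2 ≤
      1 / (G.vmeas y * (2 * t ^ 2)) := by
  classical
  have hm := G.vmeas_pos y
  by_cases hy : y ∈ S
  · lift y to S using hy
    have := Matrix.sum_sq_mul_exp_smul_le (fun v : S => G.vmeas v) (fun v => G.vmeas_pos v) (G.gen S)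
      (gen_symm hG S) (gen_nonpos hG S) ht.le y
    rw [← Finset.sum_coe_sort S fun v => G.vmeas v * G.lap (fun w => G.finKernel S w y t) v ^ 2]
    have h : ∀ v : S, G.lap (fun w => G.finKernel S w y t) v ^ 2 =
        (G.gen S * NormedSpace.exp (t • G.gen S)) v y ^ 2 / G.vmeas y ^ 2 := fun v => by
      rw [← neg_sq, neg_lap_finKernel hG, div_pow]
    simp_rw [h, ← mul_div_assoc]
    rw [← Finset.sum_div, div_le_div_iff₀ (by positivity) (by positivity)]
    nlinarith [mul_le_mul_of_nonneg_left this hm.le]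
  · simp only [finKernel_of_right _ hy, lap_const]
    simp
    positivity

include hG in
/-- The Dirichlet kernel lies below every nonnegative solution. -/
theorem sum_finKernel_mul_le (h : V → ℝ → ℝ) (h0 : ∀ v t, 0 ≤ t → 0 ≤ h v t)
    (hc : ∀ v ∈ S, ContinuousOn (h v) (Ici 0))
    (hd : ∀ v ∈ S, ∀ t, 0 < t → HasDerivAt (h v) (-G.lap (fun w => h w t) v) t)
    {t : ℝ} (ht : 0 ≤ t) (u : V) :
    ∑ y ∈ S, G.finKernel S u y t * h y 0 * G.vmeas y ≤ h u t := by
  classical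
  by_cases hu : u ∈ S
  · lift u to S using hu
    have := Matrix.exp_smul_mulVec_le (G.gen S) (gen_nonneg hG S) (fun v => h v)
      (fun v t => -G.lap (fun w => h w t) v) (fun v => hc v v.2) (fun v t ht => hd v v.2 t ht)
      (fun v t ht => ?_) ht u
    · refine le_of_eq_of_le ?_ this
      rw [← Finset.sum_coe_sort S fun y => G.finKernel S u y t * h y 0 * G.vmeas y]
      refine Finset.sum_congr rfl fun y _ => ?_
      rw [finKernel_coe]
      have := (G.vmeas_pos y).ne'
      field_simp
    -- Replacing `h` by zero off `S` only raises the Laplacian on `S`, so a nonnegative solution is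
    -- a supersolution for the Dirichlet generator.
    · rw [sum_gen_mul hG S (fun w => h w t), neg_le_neg_iff]
      refine lap_le_lap hG ?_ fun x => ?_
      · rw [indicator_of_mem (Finset.mem_coe.2 v.2)]
      · exact indicator_le_self' (fun x _ => h0 x t ht.le) x
  · simp only [finKernel_of_left hu, zero_mul, Finset.sum_const_zero]
    exact h0 u t ht

include hG in
-- Comparison with the constant solution `1`.
theorem sum_finKernel_le_one (u : V) {t : ℝ} (ht : 0 ≤ t) :
    ∑ y ∈ S, G.finKernel S u y t * G.vmeas y ≤ 1 := by
  have := sum_finKernel_mul_le (S := S) hG (fun _ _ => 1) (fun _ _ _ => zero_le_one)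
    (fun _ _ => continuousOn_const) (fun v _ t _ => by
      simp only [lap_const, neg_zero]; exact hasDerivAt_const _ _) ht u
  simpa using this

include hG in
theorem finKernel_le_inv (u v : V) {t : ℝ} (ht : 0 ≤ t) :
    G.finKernel S u v t ≤ 1 / G.vmeas v := by
  by_cases hv : v ∈ S
  · rw [le_div_iff₀ (G.vmeas_pos v)]
    exact (Finset.single_le_sum (f := fun y => G.finKernel S u y t * G.vmeas y) (fun y _ =>
      mul_nonneg (finKernel_nonneg hG u y ht) (G.vmeas_pos y).le) hv).trans
      (sum_finKernel_le_one hG u ht)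
  · rw [finKernel_of_right _ hv]
    exact (one_div_pos.2 (G.vmeas_pos v)).le

include hG in
theorem finKernel_le_of_solution (y : V) (h : V → ℝ → ℝ) (h0 : ∀ v t, 0 ≤ t → 0 ≤ h v t)
    (hc : ∀ v ∈ S, ContinuousOn (h v) (Ici 0))
    (hd : ∀ v ∈ S, ∀ t, 0 < t → HasDerivAt (h v) (-G.lap (fun w => h w t) v) t)
    (hy : y ∈ S → 1 / G.vmeas y ≤ h y 0)
    {t : ℝ} (ht : 0 ≤ t) (u : V) : G.finKernel S u y t ≤ h u t := by
  by_cases hyS : y ∈ S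
  · refine le_trans ?_ (sum_finKernel_mul_le hG h h0 hc hd ht u)
    refine le_trans ?_ (Finset.single_le_sum (f := fun y => G.finKernel S u y t * h y 0 * G.vmeas y)
      (fun y _ => mul_nonneg (mul_nonneg (finKernel_nonneg hG u y ht) (h0 y 0 le_rfl))
        (G.vmeas_pos y).le) hyS)
    have h1 := hy hyS
    rw [div_le_iff₀ (G.vmeas_pos y)] at h1
    rw [mul_assoc]
    exact le_mul_of_one_le_right (finKernel_nonneg hG u y ht) h1
  · rw [finKernel_of_right _ hyS]
    exact h0 u t ht

include hG in
-- The kernel of the larger set is a nonnegative solution on the smaller one.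
theorem finKernel_mono {T : Finset V} (hST : S ⊆ T) (u v : V) {t : ℝ} (ht : 0 ≤ t) :
    G.finKernel S u v t ≤ G.finKernel T u v t := by
  classical
  refine finKernel_le_of_solution hG v (fun w t => G.finKernel T w v t)
    (fun w t ht => finKernel_nonneg hG w v ht)
    (fun w hw s _ => (hasDerivAt_finKernel hG (hST hw) v s).continuousAt.continuousWithinAt)
    (fun w hw s _ => hasDerivAt_finKernel hG (hST hw) v s) (fun hv => ?_) ht u
  rw [finKernel_zero, if_pos ⟨hST hv, rfl⟩]

end CalcGraph

namespace CalcGraph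

open Filter Topology

variable {V : Type u} {E : Type w} {G : CalcGraph V E} (hG : G.IsLocallyFinite)

/-! ### The minimal heat kernel on vertices -/

open Classical in
/-- The interior vertices of a finite set. -/
noncomputable def interiorPart (G : CalcGraph V E) (T : Finset V) : Finset V :=
  T.filter (· ∉ G.boundary)

theorem mem_interiorPart {T : Finset V} {v : V} :
    v ∈ G.interiorPart T ↔ v ∈ T ∧ v ∉ G.boundary := by
  simp [interiorPart]

theorem interiorPart_mono {S T : Finset V} (h : S ⊆ T) : G.interiorPart S ⊆ G.interiorPart T :=
  fun _ hv => mem_interiorPart.2 ⟨h (mem_interiorPart.1 hv).1, (mem_interiorPart.1 hv).2⟩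

theorem eventually_mem_interiorPart {v : V} (hv : v ∉ G.boundary) :
    ∀ᶠ T in atTop, v ∈ G.interiorPart T := by
  filter_upwards [eventually_ge_atTop {v}] with T hT
  exact mem_interiorPart.2 ⟨hT (Finset.mem_singleton_self v), hv⟩

/-- The heat kernel on vertices, as the supremum of the Dirichlet kernels of finite sets of
interior vertices. -/
noncomputable def vKernel (G : CalcGraph V E) (u v : V) (t : ℝ) : ℝ :=
  ⨆ T : Finset V, G.finKernel (G.interiorPart T) u v t

include hG in
theorem bddAbove_finKernel (u v : V) {t : ℝ} (ht : 0 ≤ t) :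
    BddAbove (range fun T : Finset V => G.finKernel (G.interiorPart T) u v t) := by
  refine ⟨1 / G.vmeas v, ?_⟩
  rintro _ ⟨T, rfl⟩
  exact finKernel_le_inv hG u v ht

include hG in
theorem finKernel_le_vKernel (T : Finset V) (u v : V) {t : ℝ} (ht : 0 ≤ t) :
    G.finKernel (G.interiorPart T) u v t ≤ G.vKernel u v t :=
  le_ciSup (bddAbove_finKernel hG u v ht) T

include hG in
theorem tendsto_finKernel (u v : V) {t : ℝ} (ht : 0 ≤ t) :
    Tendsto (fun T => G.finKernel (G.interiorPart T) u v t) atTop (𝓝 (G.vKernel u v t)) :=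
  tendsto_atTop_ciSup (fun _ _ h => finKernel_mono hG (interiorPart_mono h) u v ht)
    (bddAbove_finKernel hG u v ht)

include hG in
theorem vKernel_nonneg (u v : V) {t : ℝ} (ht : 0 ≤ t) : 0 ≤ G.vKernel u v t :=
  (finKernel_nonneg hG u v ht).trans (finKernel_le_vKernel hG ∅ u v ht)

include hG in
theorem vKernel_symm (u v : V) (t : ℝ) : G.vKernel u v t = G.vKernel v u t := by
  unfold vKernel
  simp_rw [finKernel_symm hG u v]

theorem vKernel_of_left {u : V} (hu : u ∈ G.boundary) (v : V) (t : ℝ) : G.vKernel u v t = 0 := by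
  unfold vKernel
  simp [finKernel_of_left fun h => (mem_interiorPart.1 h).2 hu]

theorem vKernel_of_right (u : V) {v : V} (hv : v ∈ G.boundary) (t : ℝ) : G.vKernel u v t = 0 := by
  unfold vKernel
  simp [finKernel_of_right u fun h => (mem_interiorPart.1 h).2 hv]

include hG in
theorem vKernel_zero {u v : V} (hu : u ∉ G.boundary) : G.vKernel u v 0 = G.delta v u := by
  classical
  refine tendsto_nhds_unique (tendsto_finKernel hG u v le_rfl) (tendsto_const_nhds.congr' ?_)
  filter_upwards [eventually_mem_interiorPart hu] with T hT
  rw [finKernel_zero, delta]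
  simp [hT]

include hG in
theorem tendsto_lap {ι : Type*} {l : Filter ι} {F : ι → V → ℝ} {f : V → ℝ}
    (h : ∀ v, Tendsto (fun i => F i v) l (𝓝 (f v))) (v : V) :
    Tendsto (fun i => G.lap (F i) v) l (𝓝 (G.lap f v)) := by
  simp only [lap_eq_sum hG]
  exact (tendsto_finsetSum _ fun e _ => ((h v).sub (h _)).const_mul _).const_mul _

include hG in
theorem abs_lap_le {f b : V → ℝ} (h : ∀ v, |f v| ≤ b v) (v : V) :
    |G.lap f v| ≤ (G.vmeas v)⁻¹ *
      ∑ e ∈ (hG v).toFinset, G.weight e / G.len e * (b v + b (G.otherEnd e v)) := by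
  rw [lap_eq_sum hG, abs_mul, abs_of_pos (inv_pos.2 (G.vmeas_pos v))]
  refine mul_le_mul_of_nonneg_left ((Finset.abs_sum_le_sum_abs _ _).trans
    (Finset.sum_le_sum fun e _ => ?_)) (inv_pos.2 (G.vmeas_pos v)).le
  rw [abs_mul, abs_of_pos (coeff_pos G e)]
  refine mul_le_mul_of_nonneg_left ((abs_sub _ _).trans (add_le_add (h _) (h _)))
    (coeff_pos G e).le

include hG in
/-- Dirichlet kernels are Lipschitz in time, uniformly in the set. -/
theorem exists_lipschitz_finKernel (u v : V) : ∃ C : ℝ, ∀ (S : Finset V) (s t : ℝ), 0 ≤ s → 0 ≤ t →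
    |G.finKernel S u v t - G.finKernel S u v s| ≤ C * |t - s| := by
  refine ⟨(G.vmeas u)⁻¹ *
      ∑ e ∈ (hG u).toFinset, G.weight e / G.len e * (1 / G.vmeas v + 1 / G.vmeas v),
    fun S s t hs ht => ?_⟩
  by_cases hu : u ∈ S
  · have := Convex.norm_image_sub_le_of_norm_hasDerivWithin_le (f := G.finKernel S u v)
      (s := Ici 0) (C := (G.vmeas u)⁻¹ *
      ∑ e ∈ (hG u).toFinset, G.weight e / G.len e * (1 / G.vmeas v + 1 / G.vmeas v))
      (fun x _ => (hasDerivAt_finKernel hG hu v x).hasDerivWithinAt) (fun x hx => ?_) (convex_Ici 0)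
      hs ht
    · simpa only [Real.norm_eq_abs] using this
    · rw [norm_neg, Real.norm_eq_abs]
      refine abs_lap_le hG (b := fun _ => 1 / G.vmeas v) (fun w => ?_) u
      rw [abs_of_nonneg (finKernel_nonneg hG w v hx)]
      exact finKernel_le_inv hG w v hx
  · rw [finKernel_of_left hu, finKernel_of_left hu, sub_zero, abs_zero]
    refine mul_nonneg (mul_nonneg (inv_pos.2 (G.vmeas_pos u)).le (Finset.sum_nonneg fun e _ =>
      mul_nonneg (coeff_pos G e).le ?_)) (abs_nonneg _)
    have := one_div_pos.2 (G.vmeas_pos v)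
    linarith

include hG in
theorem continuousOn_vKernel (u v : V) : ContinuousOn (G.vKernel u v) (Ici 0) := by
  obtain ⟨C, hC⟩ := exists_lipschitz_finKernel hG u v
  have h : ∀ s t, 0 ≤ s → 0 ≤ t → |G.vKernel u v t - G.vKernel u v s| ≤ C * |t - s| :=
    fun s t hs ht => le_of_tendsto
      ((tendsto_finKernel hG u v ht).sub (tendsto_finKernel hG u v hs)).abs
      (.of_forall fun T => hC _ s t hs ht)
  have : LipschitzOnWith C.toNNReal (G.vKernel u v) (Ici 0) :=
    LipschitzOnWith.of_dist_le_mul fun t ht s hs => by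
      rw [Real.dist_eq, Real.dist_eq]
      exact (h s t hs ht).trans
        (mul_le_mul_of_nonneg_right (Real.le_coe_toNNReal C) (abs_nonneg _))
  exact this.continuousOn

include hG in
-- The derivative at `u` is a Laplacian, a finite combination of kernel values that are Lipschitz in
-- time with constants independent of `S`. A first-order expansion with uniform quadratic remainder
-- survives pointwise limits, so the limit is differentiable.
theorem exists_quadratic_bound_finKernel (u v : V) : ∃ C : ℝ, ∀ (S : Finset V), u ∈ S → ∀ s t : ℝ,
    0 ≤ s → 0 ≤ t → |G.finKernel S u v t - G.finKernel S u v s -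
      (t - s) * -G.lap (fun w => G.finKernel S w v s) u| ≤ C * (t - s) ^ 2 := by
  choose L hL using fun w => exists_lipschitz_finKernel hG w v
  have hL0 : ∀ w, 0 ≤ L w := fun w => by
    have := (abs_nonneg _).trans (hL w ∅ 0 1 le_rfl zero_le_one)
    simpa using this
  let C := (G.vmeas u)⁻¹ *
    ∑ e ∈ (hG u).toFinset, G.weight e / G.len e * (L u + L (G.otherEnd e u))
  have hC : 0 ≤ C := mul_nonneg (inv_pos.2 (G.vmeas_pos u)).le (Finset.sum_nonneg fun e _ =>
      mul_nonneg (coeff_pos G e).le (add_nonneg (hL0 _) (hL0 _)))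
  refine ⟨C, fun S hu s t hs ht => ?_⟩
  let d := -G.lap (fun w => G.finKernel S w v s) u
  have hder : ∀ x, HasDerivAt (fun x => G.finKernel S u v x - x * d)
      (-G.lap (fun w => G.finKernel S w v x) u - d) x := fun x => by
    simpa using (hasDerivAt_finKernel hG hu v x).fun_sub ((hasDerivAt_id' x).mul_const d)
  have hsub : uIcc s t ⊆ Ici 0 := fun x hx => (le_inf hs ht).trans hx.1
  have := Convex.norm_image_sub_le_of_norm_hasDerivWithin_le
    (f := fun x => G.finKernel S u v x - x * d) (s := uIcc s t) (C := C * |t - s|)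
    (fun x _ => (hder x).hasDerivWithinAt) (fun x hx => ?_) (convex_uIcc s t)
    left_mem_uIcc right_mem_uIcc
  · simp only [Real.norm_eq_abs] at this
    rw [mul_assoc, ← pow_two, sq_abs] at this
    refine le_of_eq_of_le ?_ this
    congr 1
    ring
  · have e : -G.lap (fun w => G.finKernel S w v x) u - d =
        G.lap (fun w => G.finKernel S w v s - G.finKernel S w v x) u := by
      rw [lap_sub hG]; simp only [d]; ring
    rw [e, Real.norm_eq_abs]
    refine (abs_lap_le hG (b := fun w => L w * |x - s|) (fun w => ?_) u).trans ?_
    · rw [abs_sub_comm]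
      exact hL w S s x hs (hsub hx)
    · have h1 : |x - s| ≤ |t - s| := abs_sub_left_of_mem_uIcc hx
      have h2 : (G.vmeas u)⁻¹ * ∑ e ∈ (hG u).toFinset, G.weight e / G.len e *
          (L u * |x - s| + L (G.otherEnd e u) * |x - s|) = C * |x - s| := by
        simp only [C]
        rw [mul_assoc, Finset.sum_mul]
        congr 1
        exact Finset.sum_congr rfl fun e _ => by ring
      rw [h2]
      exact mul_le_mul_of_nonneg_left h1 hC

theorem hasDerivAt_of_quadratic_bound {f : ℝ → ℝ} {d C t : ℝ} (ht : 0 < t)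
    (h : ∀ s, 0 ≤ s → |f s - f t - (s - t) * d| ≤ C * (s - t) ^ 2) : HasDerivAt f d t := by
  rw [hasDerivAt_iff_isLittleO]
  refine Asymptotics.IsBigO.trans_isLittleO (g := fun s => ‖s - t‖ ^ 2) ?_
    (Asymptotics.isLittleO_pow_sub_sub t one_lt_two)
  refine Asymptotics.IsBigO.of_bound C ?_
  filter_upwards [Ioi_mem_nhds ht] with s hs
  rw [Real.norm_eq_abs, Real.norm_eq_abs, Real.norm_eq_abs, sq_abs,
    abs_of_nonneg (sq_nonneg (s - t))]
  exact h s (le_of_lt hs)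

include hG in
theorem hasDerivAt_vKernel {u : V} (hu : u ∉ G.boundary) (v : V) {t : ℝ} (ht : 0 < t) :
    HasDerivAt (G.vKernel u v) (-G.lap (fun w => G.vKernel w v t) u) t := by
  obtain ⟨C, hC⟩ := exists_quadratic_bound_finKernel hG u v
  refine hasDerivAt_of_quadratic_bound ht (C := C) fun s hs => ?_
  have hl := tendsto_lap hG (fun w => tendsto_finKernel hG w v ht.le) u
  refine le_of_tendsto (((tendsto_finKernel hG u v hs).sub (tendsto_finKernel hG u v ht.le)).sub
    (hl.neg.const_mul (s - t))).abs ?_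
  filter_upwards [eventually_mem_interiorPart hu] with T hT
  exact hC _ hT t s ht.le hs

include hG in
theorem differentiableAt_vKernel (u v : V) {t : ℝ} (ht : 0 < t) :
    DifferentiableAt ℝ (G.vKernel u v) t := by
  by_cases hu : u ∈ G.boundary
  · have : G.vKernel u v = fun _ => 0 := funext (vKernel_of_left hu v)
    rw [this]
    exact differentiableAt_const _
  · exact (hasDerivAt_vKernel hG hu v ht).differentiableAt

theorem sum_finKernel_superset {S T : Finset V} (h : S ⊆ T) (u : V) (s : ℝ) (f : V → ℝ) :
    ∑ w ∈ T, G.finKernel S u w s * f w = ∑ w ∈ S, G.finKernel S u w s * f w :=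
  (Finset.sum_subset h fun w _ hw => by rw [finKernel_of_right _ hw, zero_mul]).symm

include hG in
-- Monotone convergence, with the terms nonnegative and increasing along the exhaustion.
theorem hasSum_vKernel (u v : V) {s t : ℝ} (hs : 0 ≤ s) (ht : 0 ≤ t) :
    HasSum (fun w => G.vKernel u w s * G.vKernel w v t * G.vmeas w) (G.vKernel u v (s + t)) := by
  classical
  have hnn : ∀ w, 0 ≤ G.vKernel u w s * G.vKernel w v t * G.vmeas w := fun w =>
    mul_nonneg (mul_nonneg (vKernel_nonneg hG u w hs) (vKernel_nonneg hG w v ht)) (G.vmeas_pos w).le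
  refine hasSum_of_isLUB_of_nonneg _ hnn ⟨?_, ?_⟩
  · rintro _ ⟨F, rfl⟩
    refine le_of_tendsto (tendsto_finsetSum F fun w _ => ((tendsto_finKernel hG u w hs).mul
      (tendsto_finKernel hG w v ht)).mul_const _) (.of_forall fun T => ?_)
    refine le_trans ?_ (finKernel_le_vKernel hG T u v (add_nonneg hs ht))
    rw [finKernel_add]
    simp_rw [mul_assoc]
    rw [← sum_finKernel_superset (T := F ∪ G.interiorPart T) Finset.subset_union_right]
    exact Finset.sum_le_sum_of_subset_of_nonneg Finset.subset_union_left fun w _ _ =>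
      mul_nonneg (finKernel_nonneg hG u w hs)
        (mul_nonneg (finKernel_nonneg hG w v ht) (G.vmeas_pos w).le)
  · intro b hb
    refine ciSup_le fun T => ?_
    rw [finKernel_add]
    refine le_trans (Finset.sum_le_sum fun w _ => ?_) (hb ⟨G.interiorPart T, rfl⟩)
    refine mul_le_mul_of_nonneg_right (mul_le_mul (finKernel_le_vKernel hG T u w hs)
      (finKernel_le_vKernel hG T w v ht) (finKernel_nonneg hG w v ht) (vKernel_nonneg hG u w hs))
      (G.vmeas_pos w).le

theorem deriv_finKernel_of_left {S : Finset V} {u : V} (hu : u ∉ S) (v : V) (t : ℝ) :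
    deriv (G.finKernel S u v) t = 0 := by
  have : G.finKernel S u v = fun _ => 0 := funext (finKernel_of_left hu v)
  rw [this, deriv_const]

include hG in
theorem tendsto_deriv_finKernel (u v : V) {t : ℝ} (ht : 0 < t) :
    Tendsto (fun T => deriv (G.finKernel (G.interiorPart T) u v) t) atTop
      (𝓝 (deriv (G.vKernel u v) t)) := by
  by_cases hu : u ∈ G.boundary
  · have : G.vKernel u v = fun _ => 0 := funext (vKernel_of_left hu v)
    rw [this, deriv_const]
    simp_rw [deriv_finKernel_of_left fun h => (mem_interiorPart.1 h).2 hu]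
    exact tendsto_const_nhds
  · rw [(hasDerivAt_vKernel hG hu v ht).deriv]
    refine (tendsto_lap hG (fun w => tendsto_finKernel hG w v ht.le) u).neg.congr' ?_
    filter_upwards [eventually_mem_interiorPart hu] with T hT
    rw [(hasDerivAt_finKernel hG hT v t).deriv]

include hG in
theorem deriv_finKernel_add (S : Finset V) (u v : V) (s t : ℝ) :
    deriv (G.finKernel S u v) (s + t) =
      ∑ w ∈ S, G.finKernel S u w s * deriv (G.finKernel S w v) t * G.vmeas w := by
  by_cases hu : u ∈ S
  · rw [(hasDerivAt_finKernel hG hu v _).deriv, lap_finKernel_add hG hu, ← Finset.sum_neg_distrib]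
    refine Finset.sum_congr rfl fun w hw => ?_
    rw [(hasDerivAt_finKernel hG hw v _).deriv]
    ring
  · simp [deriv_finKernel_of_left hu, finKernel_of_left hu]

include hG in
-- The terms have no sign, so monotone convergence is replaced by Cauchy–Schwarz on the tail: `∑
-- K(u,w,s)² 𝒱(w) = K(u,u,2s)` converges, and the time derivatives have weighted `ℓ²` norm squared
-- at most `B`, uniformly in the finite set.
theorem hasSum_deriv_vKernel (u v : V) {s t : ℝ} (hs : 0 ≤ s) (ht : 0 < t) :
    HasSum (fun w => G.vKernel u w s * deriv (G.vKernel w v) t * G.vmeas w)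
      (deriv (G.vKernel u v) (s + t)) := by
  classical
  have hst : 0 < s + t := by linarith
  let B := 1 / (G.vmeas v * (2 * t ^ 2))
  have hB : 0 < B := by have := G.vmeas_pos v; positivity
  have hsum : Summable fun w => G.vKernel u w s ^ 2 * G.vmeas w := by
    refine (hasSum_vKernel hG u u hs hs).summable.congr fun w => ?_
    rw [vKernel_symm hG w u, pow_two]
  rw [HasSum, SummationFilter.unconditional_filter, Metric.tendsto_atTop]
  intro ε hε
  -- Multiplied by `B`, this tail bound becomes `(ε/2)²`.
  obtain ⟨F₀, hF₀⟩ := summable_iff_vanishing_norm.1 hsum (ε ^ 2 / (4 * B)) (by positivity)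
  refine ⟨F₀, fun F hF => ?_⟩
  suffices h : |deriv (G.vKernel u v) (s + t) -
      ∑ w ∈ F, G.vKernel u w s * deriv (G.vKernel w v) t * G.vmeas w| ≤ ε / 2 by
    rw [dist_comm, Real.dist_eq]
    linarith
  refine le_of_tendsto ((tendsto_deriv_finKernel hG u v hst).sub (tendsto_finsetSum F fun w _ =>
    ((tendsto_finKernel hG u w hs).mul (tendsto_deriv_finKernel hG w v ht)).mul_const _)).abs
    (.of_forall fun T => ?_)
  set S := G.interiorPart T
  have h1 : deriv (G.finKernel S u v) (s + t) -
      ∑ w ∈ F, G.finKernel S u w s * deriv (G.finKernel S w v) t * G.vmeas w =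
      ∑ w ∈ S \ F, G.finKernel S u w s * deriv (G.finKernel S w v) t * G.vmeas w := by
    rw [deriv_finKernel_add hG]
    simp_rw [mul_assoc]
    rw [← sum_finKernel_superset (T := F ∪ S) Finset.subset_union_right,
      ← Finset.sum_sdiff (Finset.subset_union_left (s₁ := F) (s₂ := S)), Finset.union_sdiff_left]
    ring
  rw [h1]
  refine abs_le_of_sq_le_sq ?_ (by positivity)
  have h2 := Finset.sum_sq_le_sum_mul_sum_of_sq_le_mul (S \ F)
    (r := fun w => G.finKernel S u w s * deriv (G.finKernel S w v) t * G.vmeas w)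
    (f := fun w => G.finKernel S u w s ^ 2 * G.vmeas w)
    (g := fun w => G.vmeas w * deriv (G.finKernel S w v) t ^ 2)
    (fun w _ => mul_nonneg (sq_nonneg _) (G.vmeas_pos w).le)
    (fun w _ => mul_nonneg (G.vmeas_pos w).le (sq_nonneg _)) (fun w _ => le_of_eq (by ring))
  have h3 : ∑ w ∈ S \ F, G.finKernel S u w s ^ 2 * G.vmeas w ≤ ε ^ 2 / (4 * B) := by
    have := hF₀ (S \ F) (Finset.sdiff_disjoint.mono_right hF)
    refine le_trans (Finset.sum_le_sum fun w _ => ?_) ((le_abs_self _).trans this.le)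
    exact mul_le_mul_of_nonneg_right (pow_le_pow_left₀ (finKernel_nonneg hG u w hs)
      (finKernel_le_vKernel hG T u w hs) 2) (G.vmeas_pos w).le
  have h4 : ∑ w ∈ S \ F, G.vmeas w * deriv (G.finKernel S w v) t ^ 2 ≤ B := by
    refine le_trans (Finset.sum_le_sum_of_subset_of_nonneg Finset.sdiff_subset fun w _ _ =>
      mul_nonneg (G.vmeas_pos w).le (sq_nonneg _)) ?_
    refine le_of_eq_of_le (Finset.sum_congr rfl fun w hw => ?_) (sum_sq_lap_finKernel_le (S := S) hG v ht)
    rw [(hasDerivAt_finKernel hG hw v t).deriv, neg_sq]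
  calc _ ≤ _ := h2
    _ ≤ ε ^ 2 / (4 * B) * B := mul_le_mul h3 h4
        (Finset.sum_nonneg fun w _ => mul_nonneg (G.vmeas_pos w).le (sq_nonneg _)) (by positivity)
    _ = (ε / 2) ^ 2 := by field_simp; ring

end CalcGraph

namespace CalcGraph

open Filter Topology

variable {V : Type u} {E : Type w} {G : CalcGraph V E}

/-! ### Linear interpolation along edges -/

/-- The edgewise linear extension of a function on the vertices. -/
noncomputable def lin (G : CalcGraph V E) (f : V → ℝ) : G.Realization → ℝ
  | .vertex v => f v
  | .inner e s => (1 - s / G.len e) * f (G.src e) + (s / G.len e) * f (G.tgt e)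

theorem param_of_mem_Ioo (e : E) (s : Icc (0 : ℝ) (G.len e)) (h : (s : ℝ) ∈ Ioo 0 (G.len e)) :
    G.param e s = .inner e ⟨s, h⟩ := by
  rw [param, dif_neg h.1.ne', dif_neg h.2.ne]

theorem param_zero (e : E) (s : Icc (0 : ℝ) (G.len e)) (h : (s : ℝ) = 0) :
    G.param e s = .vertex (G.src e) := by
  rw [param, dif_pos h]

theorem param_len (e : E) (s : Icc (0 : ℝ) (G.len e)) (h : (s : ℝ) = G.len e) :
    G.param e s = .vertex (G.tgt e) := by
  rw [param, dif_neg (h.trans_ne (G.len_pos e).ne'), dif_pos h]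

theorem edgewiseLinear_lin (f : V → ℝ) : G.EdgewiseLinear (G.lin f) := by
  intro e s
  have hl := (G.len_pos e).ne'
  by_cases h0 : (s : ℝ) = 0
  · rw [param_zero e s h0]; simp [lin, h0]
  by_cases h1 : (s : ℝ) = G.len e
  · rw [param_len e s h1]; simp [lin, h1, hl]
  · rw [param_of_mem_Ioo e s ⟨lt_of_le_of_ne s.2.1 (Ne.symm h0), lt_of_le_of_ne s.2.2 h1⟩]
    rfl

theorem EdgewiseLinear.eq_lin {F : G.Realization → ℝ} (h : G.EdgewiseLinear F)
    (x : G.Realization) : F x = G.lin (fun v => F (.vertex v)) x := by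
  cases x with
  | vertex v => rfl
  | inner e s =>
    have := h e ⟨s, s.2.1.le, s.2.2.le⟩
    rwa [param_of_mem_Ioo e _ s.2] at this

theorem continuous_lin (f : V → ℝ) : Continuous (G.lin f) := by
  refine continuous_iSup_dom.2 fun e => continuous_coinduced_dom.2 ?_
  have : G.lin f ∘ G.param e = fun s : Icc (0 : ℝ) (G.len e) => (1 - (s : ℝ) / G.len e) * f (G.src e)
      + ((s : ℝ) / G.len e) * f (G.tgt e) := funext (edgewiseLinear_lin f e)
  rw [this]
  fun_prop

/-- The weights depend on `x` alone and not on `f`, so linear identities and inequalities at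
vertices pass to all points. -/
theorem exists_lin_eq (G : CalcGraph V E) (x : G.Realization) : ∃ (u v : V) (a b : ℝ),
    0 ≤ a ∧ 0 ≤ b ∧ a + b = 1 ∧ ∀ f, G.lin f x = a * f u + b * f v := by
  cases x with
  | vertex v => exact ⟨v, v, 1, 0, zero_le_one, le_rfl, add_zero 1, fun f => by simp [lin]⟩
  | inner e s =>
    have hl := G.len_pos e
    refine ⟨G.src e, G.tgt e, 1 - s / G.len e, s / G.len e, ?_, div_nonneg s.2.1.le hl.le,
      by ring, fun f => rfl⟩
    rw [sub_nonneg, div_le_one hl]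
    exact s.2.2.le

open Classical in
-- The open stars where a hat function is positive cover the realization. On the star of `v`,
-- interpolation is a finite sum over `nbrs hG v`, which yields joint continuity in space and time.
theorem exists_lin_single_pos (x : G.Realization) : ∃ v, 0 < G.lin (Pi.single v 1) x := by
  obtain ⟨u, v, a, b, ha, hb, hab, h⟩ := G.exists_lin_eq x
  have hs : ∀ u v : V, 0 ≤ Pi.single (M := fun _ => ℝ) u 1 v := fun u v => by
    rw [Pi.single_apply]; split_ifs <;> norm_num
  rcases ha.lt_or_eq with ha | ha
  · refine ⟨u, ?_⟩
    rw [h, Pi.single_eq_same, mul_one]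
    have := mul_nonneg hb (hs u v)
    linarith
  · refine ⟨v, ?_⟩
    rw [h, Pi.single_eq_same, ← ha]
    linarith

open Classical in
/-- The endpoints of the edges at `v`. -/
noncomputable def nbrs (hG : G.IsLocallyFinite) (v : V) : Finset V :=
  insert v ((hG v).toFinset.image G.src ∪ (hG v).toFinset.image G.tgt)

open Classical in
theorem lin_eq_sum_nbrs (hG : G.IsLocallyFinite) {v : V} {x : G.Realization}
    (hx : 0 < G.lin (Pi.single v 1) x) (f : V → ℝ) :
    G.lin f x = ∑ u ∈ nbrs hG v, f u * G.lin (Pi.single u 1) x := by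
  have key : ∀ w ∈ nbrs hG v, ∑ u ∈ nbrs hG v, f u * Pi.single (M := fun _ => ℝ) u 1 w = f w := by
    intro w hw
    simp [Pi.single_apply, hw]
  cases x with
  | vertex w =>
    have : w = v := by
      by_contra h
      exact hx.ne' (Pi.single_eq_of_ne h _)
    subst this
    exact (key w (Finset.mem_insert_self _ _)).symm
  | inner e s =>
    have he : e ∈ (hG v).toFinset := by
      rw [Finite.mem_toFinset]
      by_contra h
      have h1 : G.src e ≠ v := fun h' => h (Or.inl h')
      have h2 : G.tgt e ≠ v := fun h' => h (Or.inr h')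
      simp [lin, Pi.single_eq_of_ne h1, Pi.single_eq_of_ne h2] at hx
    have h1 := key (G.src e) (Finset.mem_insert_of_mem
      (Finset.mem_union_left _ (Finset.mem_image_of_mem _ he)))
    have h2 := key (G.tgt e) (Finset.mem_insert_of_mem
      (Finset.mem_union_right _ (Finset.mem_image_of_mem _ he)))
    simp only [lin]
    rw [← h1, ← h2, Finset.mul_sum, Finset.mul_sum, ← Finset.sum_add_distrib]
    exact Finset.sum_congr rfl fun u _ => by ring

theorem continuousOn_lin (hG : G.IsLocallyFinite) {c : V → ℝ → ℝ} {s : Set ℝ}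
    (hc : ∀ v, ContinuousOn (c v) s) :
    ContinuousOn (fun p : G.Realization × ℝ => G.lin (fun v => c v p.2) p.1) (univ ×ˢ s) := by
  classical
  rintro ⟨x, t⟩ hp
  obtain ⟨v, hv⟩ := exists_lin_single_pos x
  have hcont : ContinuousOn (fun p : G.Realization × ℝ => ∑ u ∈ nbrs hG v,
      c u p.2 * G.lin (Pi.single u 1) p.1) (univ ×ˢ s) := by
    refine continuousOn_finsetSum _ fun u _ => ContinuousOn.mul ?_ ?_
    · exact (hc u).comp continuous_snd.continuousOn fun p hp => hp.2
    · exact ((continuous_lin _).comp continuous_fst).continuousOn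
  refine (hcont _ hp).congr_of_eventuallyEq ?_ (lin_eq_sum_nbrs hG hv _)
  have hU : ∀ᶠ p : G.Realization × ℝ in 𝓝 (x, t), 0 < G.lin (Pi.single v 1) p.1 :=
    ((continuous_lin _).comp continuous_fst).continuousAt.eventually (lt_mem_nhds hv)
  filter_upwards [mem_nhdsWithin_of_mem_nhds hU] with p hp
  exact lin_eq_sum_nbrs hG hp _

/-! ### The minimal heat kernel -/

/-- The edgewise linear extension of the heat kernel on the vertices. -/
noncomputable def minKernel (G : CalcGraph V E) (x y : G.Realization) (t : ℝ) : ℝ :=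
  G.lin (fun u => G.lin (fun v => G.vKernel u v t) y) x

theorem minKernel_vertex_right (x : G.Realization) (v : V) (t : ℝ) :
    G.minKernel x (.vertex v) t = G.lin (fun u => G.vKernel u v t) x := rfl

theorem minKernel_vertex_left (u : V) (y : G.Realization) (t : ℝ) :
    G.minKernel (.vertex u) y t = G.lin (fun v => G.vKernel u v t) y := rfl

theorem lin_nonneg {f : V → ℝ} (hf : ∀ v, 0 ≤ f v) (x : G.Realization) : 0 ≤ G.lin f x := by
  obtain ⟨u, v, a, b, ha, hb, -, h⟩ := G.exists_lin_eq x
  rw [h]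
  exact add_nonneg (mul_nonneg ha (hf u)) (mul_nonneg hb (hf v))

theorem lin_mono {f g : V → ℝ} (hf : ∀ v, f v ≤ g v) (x : G.Realization) :
    G.lin f x ≤ G.lin g x := by
  obtain ⟨u, v, a, b, ha, hb, -, h⟩ := G.exists_lin_eq x
  rw [h, h]
  exact add_le_add (mul_le_mul_of_nonneg_left (hf u) ha) (mul_le_mul_of_nonneg_left (hf v) hb)

variable (hG : G.IsLocallyFinite)

include hG in
theorem isFundamentalSolution_minKernel : G.IsFundamentalSolution G.minKernel where
  solves y hy := by
    refine ⟨⟨?_, ?_, ?_⟩, ?_, ?_⟩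
    · exact continuousOn_lin hG fun v => continuousOn_vKernel hG v y
    · exact fun t _ => edgewiseLinear_lin _
    · exact fun v hv t ht => hasDerivAt_vKernel hG hv y ht
    · exact fun v hv => vKernel_zero hG hv
    · exact fun v hv t _ => vKernel_of_left hv y t
  boundary_right y hy x t _ := by
    rw [minKernel_vertex_right]
    obtain ⟨u, v, a, b, -, -, -, h⟩ := G.exists_lin_eq x
    simp [h, vKernel_of_right _ hy]
  linear_left y t _ := edgewiseLinear_lin _
  linear_right x t _ := by
    obtain ⟨u, v, a, b, -, -, -, h⟩ := G.exists_lin_eq x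
    intro e s
    simp only [minKernel, h]
    rw [edgewiseLinear_lin _ e s, edgewiseLinear_lin _ e s]
    ring

include hG in
theorem minKernel_symm (x y : G.Realization) (t : ℝ) : G.minKernel x y t = G.minKernel y x t := by
  obtain ⟨u, v, a, b, -, -, -, h⟩ := G.exists_lin_eq x
  obtain ⟨u', v', a', b', -, -, -, h'⟩ := G.exists_lin_eq y
  simp only [minKernel, h, h']
  rw [vKernel_symm hG u u', vKernel_symm hG u v', vKernel_symm hG v u', vKernel_symm hG v v']
  ring

include hG in
theorem isHeatKernel_minKernel : G.IsHeatKernel G.minKernel where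
  toIsFundamentalSolution := isFundamentalSolution_minKernel hG
  symm x y t _ := minKernel_symm hG x y t
  selfReproducing x y τ t hτ ht := by
    obtain ⟨u, v, a, b, -, -, -, h⟩ := G.exists_lin_eq x
    obtain ⟨u', v', a', b', -, -, -, h'⟩ := G.exists_lin_eq y
    have hs : ∀ u v, HasSum (fun w => G.vKernel u w τ * G.vKernel w v (t - τ) * G.vmeas w)
        (G.vKernel u v t) := fun u v => by
      simpa using hasSum_vKernel hG u v hτ (sub_nonneg.2 ht)
    simp only [minKernel_vertex_right, minKernel_vertex_left, h, h']
    rw [minKernel, h, h', h']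
    refine HasSum.congr_fun ((((hs u u').mul_left a').add ((hs u v').mul_left b')).mul_left a |>.add
      ((((hs v u').mul_left a').add ((hs v v').mul_left b')).mul_left b)) fun w => ?_
    ring
  selfReproducing_deriv x y τ t hτ ht := by
    obtain ⟨u, v, a, b, -, -, -, h⟩ := G.exists_lin_eq x
    obtain ⟨u', v', a', b', -, -, -, h'⟩ := G.exists_lin_eq y
    have hs : ∀ u v, HasSum (fun w => G.vKernel u w τ * deriv (G.vKernel w v) (t - τ) * G.vmeas w)
        (deriv (G.vKernel u v) t) := fun u v => by
      simpa using hasSum_deriv_vKernel hG u v hτ (sub_pos.2 ht)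
    have hd : ∀ w s, 0 < s → HasDerivAt (G.minKernel (.vertex w) y)
        (a' * deriv (G.vKernel w u') s + b' * deriv (G.vKernel w v') s) s := fun w s hs => by
      have := ((differentiableAt_vKernel hG w u' hs).hasDerivAt.const_mul a').fun_add
        ((differentiableAt_vKernel hG w v' hs).hasDerivAt.const_mul b')
      exact this.congr_of_eventuallyEq (.of_forall fun s => h' _)
    have hd' : HasDerivAt (G.minKernel x y)
        (a * (a' * deriv (G.vKernel u u') t + b' * deriv (G.vKernel u v') t) +
          b * (a' * deriv (G.vKernel v u') t + b' * deriv (G.vKernel v v') t)) t := by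
      have ht0 : 0 < t := hτ.trans_lt ht
      have := ((hd u t ht0).const_mul a).fun_add ((hd v t ht0).const_mul b)
      exact this.congr_of_eventuallyEq (.of_forall fun s => h _)
    rw [hd'.deriv]
    simp only [(hd _ _ (sub_pos.2 ht)).deriv, minKernel_vertex_right, h]
    refine HasSum.congr_fun ((((hs u u').mul_left a').add ((hs u v').mul_left b')).mul_left a |>.add
      ((((hs v u').mul_left a').add ((hs v v').mul_left b')).mul_left b)) fun w => ?_
    ring

include hG in
theorem isMinimalHeatKernel_minKernel : G.IsMinimalHeatKernel G.minKernel where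
  toIsHeatKernel := isHeatKernel_minKernel hG
  nonneg x y t ht := lin_nonneg (fun u => lin_nonneg (fun v => vKernel_nonneg hG u v ht) y) x
  minimal H hH hH0 x y t ht := by
    have hv : ∀ u v, G.vKernel u v t ≤ H (.vertex u) (.vertex v) t := by
      intro u v
      by_cases hv : v ∈ G.boundary
      · rw [vKernel_of_right u hv]
        exact hH0 _ _ t ht
      · have hs := hH.solves v hv
        refine ciSup_le fun T => finKernel_le_of_solution hG v
          (fun w t => H (.vertex w) (.vertex v) t) (fun w t ht => hH0 _ _ t ht) (fun w _ => ?_)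
          (fun w hw t ht => hs.heat w (mem_interiorPart.1 hw).2 t ht) (fun _ => ?_) ht u
        · exact hs.continuousOn.comp (f := fun t => (Realization.vertex w, t))
            (by fun_prop) fun t ht => ⟨mem_univ _, ht⟩
        · rw [hs.initial v hv, delta, if_pos rfl]
    rw [(hH.linear_left y t ht).eq_lin x]
    refine lin_mono (fun u => ?_) x
    rw [(hH.linear_right (.vertex u) t ht).eq_lin y]
    exact lin_mono (hv u) y

include hG in
-- Two minimal kernels each lie below the other.
theorem IsMinimalHeatKernel.eq_minKernel {K : G.Realization → G.Realization → ℝ → ℝ}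
    (hK : G.IsMinimalHeatKernel K) (x y : G.Realization) {t : ℝ} (ht : 0 ≤ t) :
    K x y t = G.minKernel x y t :=
  le_antisymm
    (hK.minimal _ (isFundamentalSolution_minKernel hG) (isMinimalHeatKernel_minKernel hG).nonneg
      x y t ht)
    ((isMinimalHeatKernel_minKernel hG).minimal K hK.toIsFundamentalSolution hK.nonneg x y t ht)

end CalcGraph

namespace CalcGraph

open Filter Topology

variable {V : Type u} {E : Type w} {G : CalcGraph V E} (hG : G.IsLocallyFinite)

/-! ### Isoperimetric inequalities for finite sets of vertices -/

/-- The open set of points at which the edgewise linear extension of the indicator function of `A`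
exceeds `1/2`. -/
noncomputable def thickening (G : CalcGraph V E) (A : Finset V) : Set G.Realization :=
  {x | 1 / 2 < G.lin ((A : Set V).indicator 1) x}

theorem vertex_mem_thickening {A : Finset V} {v : V} :
    Realization.vertex v ∈ G.thickening A ↔ v ∈ A := by
  classical
  rw [thickening, mem_ofPred_eq, lin, indicator_apply]
  by_cases h : v ∈ A <;> simp [h]
  norm_num

theorem isOpen_thickening (A : Finset V) : IsOpen (G.thickening A) :=
  isOpen_lt continuous_const (continuous_lin _)

open Classical in
/-- The edges having exactly one endpoint in `A`. -/
noncomputable def cutEdges (hG : G.IsLocallyFinite) (A : Finset V) : Finset E :=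
  (edgesOf hG A).filter fun e => ¬(G.src e ∈ A ↔ G.tgt e ∈ A)

theorem mem_cutEdges {A : Finset V} {e : E} :
    e ∈ cutEdges hG A ↔ ¬(G.src e ∈ A ↔ G.tgt e ∈ A) := by
  simp only [cutEdges, Finset.mem_filter, mem_edgesOf]
  tauto

include hG in
theorem finiteType_thickening (A : Finset V) : G.FiniteType (G.thickening A) := by
  refine ⟨A, edgesOf hG A, fun x hx => ?_⟩
  cases x with
  | vertex v => exact Or.inl ⟨v, vertex_mem_thickening.1 hx, rfl⟩
  | inner e s =>
    refine Or.inr ?_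
    simp only [mem_iUnion]
    refine ⟨e, ?_, ⟨s, s.2.1.le, s.2.2.le⟩, param_of_mem_Ioo e _ s.2⟩
    rw [mem_edgesOf]
    by_contra! h
    rw [thickening, mem_ofPred_eq] at hx
    simp [lin, h.1, h.2] at hx
    norm_num at hx

/-- The midpoint of an edge. -/
noncomputable def midpt (G : CalcGraph V E) (e : E) : G.Realization :=
  .inner e ⟨G.len e / 2, half_pos (G.len_pos e), half_lt_self (G.len_pos e)⟩

/-- On the frontier the interpolated indicator equals `1/2`, a value taken only at midpoints of
edges with exactly one end in `A`. -/
theorem frontier_thickening_subset (A : Finset V) :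
    frontier (G.thickening A) ⊆ G.midpt '' (cutEdges hG A) := by
  intro x hx
  have h : 1 / 2 = G.lin ((A : Set V).indicator 1) x :=
    frontier_lt_subset_eq continuous_const (continuous_lin _) hx
  cases x with
  | vertex v =>
    rw [lin] at h
    by_cases hv : v ∈ A <;> simp [hv] at h
  | inner e s =>
    have hl := G.len_pos e
    have hs : ∀ c : ℝ, c = G.len e / 2 → (s : ℝ) = c → Realization.inner e s = G.midpt e := by
      intro c hc hsc
      rw [midpt]
      congr 1
      exact Subtype.ext (hsc.trans hc)
    rw [lin] at h
    refine ⟨e, ?_, (hs (G.len e / 2) rfl ?_).symm⟩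
    · rw [Finset.mem_coe, mem_cutEdges]
      intro hiff
      by_cases h1 : G.src e ∈ A
      · simp [h1, hiff.1 h1] at h
      · have h2 : G.tgt e ∉ A := fun h2 => h1 (hiff.2 h2)
        simp [h1, h2] at h
    · by_cases h1 : G.src e ∈ A <;> by_cases h2 : G.tgt e ∈ A <;> simp [h1, h2] at h <;>
        field_simp at h <;> linarith

include hG in
theorem admissible_thickening {A : Finset V} (hA : ∀ v ∈ A, v ∉ G.boundary) :
    G.Admissible (G.thickening A) :=
  ⟨isOpen_thickening A, finiteType_thickening hG A,
    ((cutEdges hG A).finite_toSet.image _).subset (frontier_thickening_subset hG A),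
    fun v hv hv' => hA v (vertex_mem_thickening.1 hv') hv⟩

theorem vol_eq_ofReal {Ω : Set G.Realization} {A : Finset V}
    (h : ∀ v, Realization.vertex v ∈ Ω ↔ v ∈ A) :
    G.vol Ω = ENNReal.ofReal (∑ v ∈ A, G.vmeas v) := by
  have : {v | Realization.vertex v ∈ Ω} = (A : Set V) := Set.ext h
  rw [ENNReal.ofReal_sum_of_nonneg fun v _ => (G.vmeas_pos v).le, ← Finset.tsum_subtype']
  exact this ▸ rfl

theorem boundaryArea_thickening_le (A : Finset V) :
    G.boundaryArea (G.thickening A) ≤ ENNReal.ofReal (∑ e ∈ cutEdges hG A, G.weight e) := by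
  classical
  rw [ENNReal.ofReal_sum_of_nonneg fun e _ => (G.weight_pos e).le]
  have h1 : frontier (G.thickening A) ⊆ ((cutEdges hG A).image G.midpt : Finset _) := by
    rw [Finset.coe_image]
    exact frontier_thickening_subset hG A
  calc G.boundaryArea (G.thickening A)
      ≤ ∑' x : (((cutEdges hG A).image G.midpt : Finset _) : Set G.Realization),
          G.pointArea (G.thickening A) x := ENNReal.tsum_mono_subtype _ h1
    _ = ∑ x ∈ (cutEdges hG A).image G.midpt, G.pointArea (G.thickening A) x :=
        Finset.tsum_subtype' _ _
    _ = ∑ e ∈ cutEdges hG A, G.pointArea (G.thickening A) (G.midpt e) := by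
        refine Finset.sum_image fun e _ e' _ h => ?_
        simp only [midpt, Realization.inner.injEq] at h
        exact h.1
    _ = ∑ e ∈ cutEdges hG A, ENNReal.ofReal (G.weight e) := rfl

theorem sum_vmeas_pos {A : Finset V} (hA : A.Nonempty) : 0 < ∑ v ∈ A, G.vmeas v :=
  Finset.sum_pos (fun v _ => G.vmeas_pos v) hA

theorem sum_weight_nonneg (T : Finset E) : 0 ≤ ∑ e ∈ T, G.weight e :=
  Finset.sum_nonneg fun e _ => (G.weight_pos e).le

/-- The thickening of `A` is a competitor in the infimum. Working with real lower bounds `i` spares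
a separate treatment of an infinite isoperimetric constant. -/
theorem isoConst_mul_le {ν i : ℝ} (hν : 1 < ν) (hi : ENNReal.ofReal i ≤ G.isoConst ν)
    {A : Finset V} (hA : ∀ v ∈ A, v ∉ G.boundary) :
    i * (∑ v ∈ A, G.vmeas v) ^ (1 - 1 / ν) ≤ ∑ e ∈ cutEdges hG A, G.weight e := by
  rcases A.eq_empty_or_nonempty with rfl | hne
  -- The exponent must be nonzero for the empty set, since `0 ^ 0 = 1`.
  · have : 1 - 1 / ν ≠ 0 := by
      have : 1 / ν < 1 := by rw [div_lt_one (by linarith)]; exact hν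
      linarith
    rw [Finset.sum_empty, Real.zero_rpow this, mul_zero]
    exact sum_weight_nonneg _
  · have hM := sum_vmeas_pos (G := G) hne
    have hvol := vol_eq_ofReal (G := G) (Ω := G.thickening A) fun v => vertex_mem_thickening
    have h1 : G.isoConst ν ≤
        G.boundaryArea (G.thickening A) / G.vol (G.thickening A) ^ (1 - 1 / ν) :=
      iInf_le_of_le _ (iInf_le_of_le (admissible_thickening hG hA) (iInf_le _
        (by rw [hvol]; exact (ENNReal.ofReal_pos.2 hM).ne')))
    have hp := Real.rpow_pos_of_pos hM (1 - 1 / ν)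
    rw [hvol, ENNReal.ofReal_rpow_of_pos hM] at h1
    have h2 := hi.trans (h1.trans (ENNReal.div_le_div_right (boundaryArea_thickening_le hG A) _))
    rw [← ENNReal.ofReal_div_of_pos hp, ENNReal.ofReal_le_ofReal_iff
      (div_nonneg (sum_weight_nonneg _) hp.le), le_div_iff₀ hp] at h2
    exact h2

open Classical in
theorem isoConstClosed_mul_le [Fintype V] (hb : G.boundary = ∅) {ν i : ℝ} (hν : 1 < ν)
    (hi : ENNReal.ofReal i ≤ G.isoConstClosed ν) {A : Finset V}
    (hA : ∑ v ∈ A, G.vmeas v ≤ ∑ v ∈ Aᶜ, G.vmeas v) :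
    i * (∑ v ∈ A, G.vmeas v) ^ (1 - 1 / ν) ≤ ∑ e ∈ cutEdges hG A, G.weight e := by
  rcases A.eq_empty_or_nonempty with rfl | hne
  · have : 1 - 1 / ν ≠ 0 := by
      have : 1 / ν < 1 := by rw [div_lt_one (by linarith)]; exact hν
      linarith
    rw [Finset.sum_empty, Real.zero_rpow this, mul_zero]
    exact sum_weight_nonneg _
  · have hM := sum_vmeas_pos (G := G) hne
    have hvol := vol_eq_ofReal (G := G) (Ω := G.thickening A) fun v => vertex_mem_thickening
    have hvol' := vol_eq_ofReal (G := G) (Ω := (G.thickening A)ᶜ) (A := Aᶜ) fun v => by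
      rw [mem_compl_iff, vertex_mem_thickening, Finset.mem_compl]
    have hmin : min (G.vol (G.thickening A)) (G.vol (G.thickening A)ᶜ) =
        ENNReal.ofReal (∑ v ∈ A, G.vmeas v) := by
      rw [hvol, hvol', min_eq_left (ENNReal.ofReal_le_ofReal hA)]
    have h1 : G.isoConstClosed ν ≤ G.boundaryArea (G.thickening A) *
        min (G.vol (G.thickening A)) (G.vol (G.thickening A)ᶜ) ^ (1 / ν - 1) :=
      iInf_le_of_le _ (iInf_le_of_le (admissible_thickening hG (by simp [hb])) (iInf_le _
        (by rw [hmin]; exact (ENNReal.ofReal_pos.2 hM).ne')))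
    have hp := Real.rpow_pos_of_pos hM (1 - 1 / ν)
    rw [hmin, ENNReal.ofReal_rpow_of_pos hM] at h1
    have h2 := hi.trans (h1.trans (mul_le_mul_left (boundaryArea_thickening_le hG A) _))
    rw [← ENNReal.ofReal_mul (sum_weight_nonneg _), ENNReal.ofReal_le_ofReal_iff
      (mul_nonneg (sum_weight_nonneg _) (Real.rpow_nonneg hM.le _)),
      ← neg_sub 1, Real.rpow_neg hM.le, ← div_eq_mul_inv, le_div_iff₀ hp] at h2
    exact h2

/-- Sums of half edge areas around vertices are controlled by `ρ_sup`. -/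
theorem sum_edge_le_of_rhoSup_le {r : ℝ} (hr : 0 ≤ r) (h : G.rhoSup ≤ ENNReal.ofReal r) (v : V) :
    ∑ e ∈ (hG v).toFinset, G.weight e * G.len e / 2 ≤ r * G.vmeas v := by
  have hm := G.vmeas_pos v
  have h1 : G.halfDegree v ≤ ENNReal.ofReal r := (le_iSup G.halfDegree v).trans h
  have hpos : ∀ e, 0 ≤ G.weight e * G.len e / 2 := fun e => by
    have := G.weight_pos e; have := G.len_pos e; positivity
  have h2 : ∑' e : G.incident v, ENNReal.ofReal (G.weight e * G.len e / 2) =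
      ENNReal.ofReal (∑ e ∈ (hG v).toFinset, G.weight e * G.len e / 2) := by
    rw [ENNReal.ofReal_sum_of_nonneg fun e _ => hpos e, ← Finset.tsum_subtype',
      Finite.coe_toFinset]
  rw [halfDegree, h2, ENNReal.div_le_iff (ENNReal.ofReal_pos.2 hm).ne' ENNReal.ofReal_ne_top,
    ← ENNReal.ofReal_mul hr, ENNReal.ofReal_le_ofReal_iff (mul_nonneg hr hm.le)] at h1
  exact h1

end CalcGraph

/-! ### Weighted norm inequalities, medians, and the passage from Sobolev to Nash -/

section WeightedMinkowski

variable {ι : Type*}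

/-- The weights are absorbed into the functions as `m ^ (1 / p)`. -/
theorem Real.weighted_Lp_add_le (s : Finset ι) (m f g : ι → ℝ) {p : ℝ} (hp : 1 ≤ p)
    (hm : ∀ i, 0 ≤ m i) (hf : ∀ i, 0 ≤ f i) (hg : ∀ i, 0 ≤ g i) :
    (∑ i ∈ s, m i * (f i + g i) ^ p) ^ (1 / p) ≤
      (∑ i ∈ s, m i * f i ^ p) ^ (1 / p) + (∑ i ∈ s, m i * g i ^ p) ^ (1 / p) := by
  have hp0 : p ≠ 0 := by linarith
  have key : ∀ i x, 0 ≤ x → (m i ^ (1 / p) * x) ^ p = m i * x ^ p := fun i x hx => by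
    rw [Real.mul_rpow (Real.rpow_nonneg (hm i) _) hx, ← Real.rpow_mul (hm i), one_div,
      inv_mul_cancel₀ hp0, Real.rpow_one]
  have := Real.Lp_add_le_of_nonneg (s := s) (f := fun i => m i ^ (1 / p) * f i)
    (g := fun i => m i ^ (1 / p) * g i) hp
    (fun i _ => mul_nonneg (Real.rpow_nonneg (hm i) _) (hf i))
    (fun i _ => mul_nonneg (Real.rpow_nonneg (hm i) _) (hg i))
  simp_rw [← mul_add] at this
  simpa only [key _ _ (hf _), key _ _ (hg _), key _ _ (add_nonneg (hf _) (hg _))] using this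

/-- Interpolation of the weighted `L²` norm between `L¹` and `L^{2ν/(ν-1)}`. -/
theorem Real.weighted_interpolation (s : Finset ι) (m f : ι → ℝ) {ν : ℝ} (hν : 1 < ν)
    (hm : ∀ i, 0 < m i) :
    (∑ i ∈ s, m i * f i ^ 2) ^ (1 + 1 / ν) ≤ (∑ i ∈ s, m i * |f i|) ^ (2 / ν) *
      (∑ i ∈ s, m i * (f i ^ 2) ^ (ν / (ν - 1))) ^ (1 - 1 / ν) := by
  have h1 : 0 < ν - 1 := by linarith
  have h2 : 0 < ν + 1 := by linarith
  have h0 : 0 < ν := by linarith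
  set X := ∑ i ∈ s, m i * |f i|
  set Y := ∑ i ∈ s, m i * (f i ^ 2) ^ (ν / (ν - 1))
  have hX : 0 ≤ X := Finset.sum_nonneg fun i _ => mul_nonneg (hm i).le (abs_nonneg _)
  have hY : 0 ≤ Y := Finset.sum_nonneg fun i _ =>
    mul_nonneg (hm i).le (Real.rpow_nonneg (sq_nonneg _) _)
  -- Hölder exponents chosen so that `m` appears to the total power `1` and `|f|` to the total power
  -- `2`.
  have hpq : ((ν + 1) / 2).HolderConjugate ((ν + 1) / (ν - 1)) := by
    rw [Real.holderConjugate_iff]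
    constructor
    · rw [lt_div_iff₀ two_pos]; linarith
    · field_simp; ring
  have hle : ∑ i ∈ s, m i * f i ^ 2 ≤ X ^ (2 / (ν + 1)) * Y ^ ((ν - 1) / (ν + 1)) := by
    have := Real.inner_le_Lp_mul_Lq_of_nonneg s hpq
      (f := fun i => (m i * |f i|) ^ (2 / (ν + 1)))
      (g := fun i => (m i * (f i ^ 2) ^ (ν / (ν - 1))) ^ ((ν - 1) / (ν + 1)))
      (fun i _ => Real.rpow_nonneg (mul_nonneg (hm i).le (abs_nonneg _)) _)
      (fun i _ => Real.rpow_nonneg (mul_nonneg (hm i).le (Real.rpow_nonneg (sq_nonneg _) _)) _)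
    have e1 : ∀ i, ((m i * |f i|) ^ (2 / (ν + 1))) ^ ((ν + 1) / 2) = m i * |f i| := fun i => by
      rw [← Real.rpow_mul (mul_nonneg (hm i).le (abs_nonneg _))]
      rw [show 2 / (ν + 1) * ((ν + 1) / 2) = 1 by field_simp, Real.rpow_one]
    have e2 : ∀ i, ((m i * (f i ^ 2) ^ (ν / (ν - 1))) ^ ((ν - 1) / (ν + 1))) ^
        ((ν + 1) / (ν - 1)) = m i * (f i ^ 2) ^ (ν / (ν - 1)) := fun i => by
      rw [← Real.rpow_mul (mul_nonneg (hm i).le (Real.rpow_nonneg (sq_nonneg _) _))]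
      rw [show (ν - 1) / (ν + 1) * ((ν + 1) / (ν - 1)) = 1 by field_simp, Real.rpow_one]
    have e3 : ∀ i, (m i * |f i|) ^ (2 / (ν + 1)) *
        (m i * (f i ^ 2) ^ (ν / (ν - 1))) ^ ((ν - 1) / (ν + 1)) = m i * f i ^ 2 := fun i => by
      rw [Real.mul_rpow (hm i).le (abs_nonneg _),
        Real.mul_rpow (hm i).le (Real.rpow_nonneg (sq_nonneg _) _), ← Real.rpow_mul (sq_nonneg _),
        mul_mul_mul_comm, ← Real.rpow_add (hm i),
        show 2 / (ν + 1) + (ν - 1) / (ν + 1) = 1 by field_simp; ring, Real.rpow_one]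
      congr 1
      rcases (abs_nonneg (f i)).eq_or_lt with h | h
      · have hf : f i = 0 := abs_eq_zero.1 h.symm
        rw [hf, abs_zero, Real.zero_rpow (by positivity)]
        simp
      · rw [← sq_abs (f i), ← Real.rpow_natCast, ← Real.rpow_mul h.le, ← Real.rpow_add h]
        congr 1
        push_cast
        field_simp
        ring
    simp only [e1, e2, e3] at this
    refine this.trans_eq ?_
    congr 2 <;> field_simp
  calc _ ≤ (X ^ (2 / (ν + 1)) * Y ^ ((ν - 1) / (ν + 1))) ^ (1 + 1 / ν) :=
        Real.rpow_le_rpow (Finset.sum_nonneg fun i _ => mul_nonneg (hm i).le (sq_nonneg _)) hle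
          (by positivity)
    _ = _ := by
        rw [Real.mul_rpow (Real.rpow_nonneg hX _) (Real.rpow_nonneg hY _), ← Real.rpow_mul hX,
          ← Real.rpow_mul hY]
        congr 2 <;> field_simp

open Classical in
-- Take `c` to be the least value of `f` with at most half the mass strictly above it. The next
-- smaller value fails this test, so at most half the mass lies strictly below `c`.
theorem exists_weighted_median [Fintype ι] [Nonempty ι] (m f : ι → ℝ) (hm : ∀ i, 0 ≤ m i) :
    ∃ c, 2 * ∑ i with c < f i, m i ≤ ∑ i, m i ∧ 2 * ∑ i with f i < c, m i ≤ ∑ i, m i := by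
  have hM : 0 ≤ ∑ i, m i := Finset.sum_nonneg fun i _ => hm i
  let T : Finset ι := Finset.univ.filter fun j => 2 * ∑ i with f j < f i, m i ≤ ∑ i, m i
  have hT : T.Nonempty := by
    obtain ⟨j, -, hj⟩ := Finset.exists_max_image Finset.univ f Finset.univ_nonempty
    refine ⟨j, Finset.mem_filter.2 ⟨Finset.mem_univ j, ?_⟩⟩
    rw [Finset.filter_false_of_mem fun i _ => not_lt.2 (hj i (Finset.mem_univ i)),
      Finset.sum_empty, mul_zero]
    exact hM
  obtain ⟨j, hjT, hj⟩ := Finset.exists_min_image T f hT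
  refine ⟨f j, (Finset.mem_filter.1 hjT).2, ?_⟩
  rcases (Finset.univ.filter fun i => f i < f j).eq_empty_or_nonempty with h | h
  · rw [h, Finset.sum_empty, mul_zero]
    exact hM
  · obtain ⟨k, hk, hmax⟩ := Finset.exists_max_image _ f h
    have hk' : f k < f j := (Finset.mem_filter.1 hk).2
    have hkT : ¬2 * ∑ i with f k < f i, m i ≤ ∑ i, m i := fun hk2 =>
      (hj k (Finset.mem_filter.2 ⟨Finset.mem_univ k, hk2⟩)).not_gt hk'
    have hfil : (Finset.univ.filter fun i => f i < f j) =
        Finset.univ.filter fun i => ¬f k < f i := by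
      refine Finset.filter_congr fun i _ => ⟨fun hi => not_lt.2 (hmax i ?_), fun hi => ?_⟩
      · exact Finset.mem_filter.2 ⟨Finset.mem_univ i, hi⟩
      · exact (not_lt.1 hi).trans_lt hk'
    have := Finset.sum_filter_add_sum_filter_not Finset.univ (fun i => f k < f i) m
    rw [hfil]
    linarith

open Classical in
-- A median minimizes the `L¹` distance to constants; here it is compared with the constant `0`. For
-- `c ≥ 0` the pointwise inequality is `|f - c| ≤ |f| - c + 2c·1_{f < c}`.
theorem sum_abs_sub_median_le [Fintype ι] (m f : ι → ℝ) (hm : ∀ i, 0 ≤ m i) {c : ℝ}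
    (h1 : 2 * ∑ i with c < f i, m i ≤ ∑ i, m i) (h2 : 2 * ∑ i with f i < c, m i ≤ ∑ i, m i) :
    ∑ i, m i * |f i - c| ≤ ∑ i, m i * |f i| := by
  rw [Finset.sum_filter] at h1 h2
  rcases le_total 0 c with hc | hc
  · have key : ∀ i, m i * |f i - c| ≤ m i * |f i| - c * (m i - 2 * if f i < c then m i else 0) := by
      intro i
      have := hm i
      split_ifs with h
      · rw [abs_of_neg (sub_neg.2 h)]
        nlinarith [neg_abs_le (f i)]
      · rw [abs_of_nonneg (sub_nonneg.2 (not_lt.1 h))]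
        nlinarith [le_abs_self (f i)]
    refine (Finset.sum_le_sum fun i _ => key i).trans ?_
    rw [Finset.sum_sub_distrib, ← Finset.mul_sum, Finset.sum_sub_distrib, ← Finset.mul_sum]
    nlinarith
  · have key : ∀ i, m i * |f i - c| ≤ m i * |f i| + c * (m i - 2 * if c < f i then m i else 0) := by
      intro i
      have := hm i
      split_ifs with h
      · rw [abs_of_pos (sub_pos.2 h)]
        nlinarith [le_abs_self (f i)]
      · rw [abs_of_nonpos (sub_nonpos.2 (not_lt.1 h))]
        nlinarith [neg_abs_le (f i)]
    refine (Finset.sum_le_sum fun i _ => key i).trans ?_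
    rw [Finset.sum_add_distrib, ← Finset.mul_sum, Finset.sum_sub_distrib, ← Finset.mul_sum]
    nlinarith

/-- `N1` and `N2` stand for `‖f‖₁` and `‖f‖₂²`, `Np` for the `L^{ν/(ν-1)}` norm of `f²`, `Q` for the
variation of `f²`, `En` for the energy. Sobolev and Cauchy–Schwarz give `c² Np² ≤ En · N2`;
interpolation bounds `Np` below, and one factor `N2` cancels. -/
theorem nash_of_sobolev {ν c r B N1 N2 Np En Q : ℝ} (hν : 0 < ν) (hc : 0 < c) (hr : 0 < r)
    (hB : 0 < B) (hN1 : 0 ≤ N1) (hN1B : N1 ≤ B) (hN2 : 0 ≤ N2) (hNp : 0 ≤ Np) (hEn : 0 ≤ En)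
    (hint : N2 ^ (1 + 1 / ν) ≤ N1 ^ (2 / ν) * Np) (hsob : 2 * c * √r * Np ≤ Q)
    (hQ : Q ^ 2 ≤ En * (4 * r * N2)) : (B ^ (-(2 / ν)) * c) ^ 2 * N2 ^ (1 + 2 / ν) ≤ En := by
  rcases hN2.eq_or_lt with h | hN2
  · rw [← h, Real.zero_rpow (by positivity), mul_zero]
    exact hEn
  have h1 : (2 * c * √r * Np) ^ 2 ≤ En * (4 * r * N2) :=
    (pow_le_pow_left₀ (by positivity) hsob 2).trans hQ
  have h2 : c ^ 2 * Np ^ 2 ≤ En * N2 := by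
    have h3 : (2 * c * √r * Np) ^ 2 = 4 * r * (c ^ 2 * Np ^ 2) := by
      have := Real.sq_sqrt hr.le
      linear_combination 4 * c ^ 2 * Np ^ 2 * this
    rw [h3] at h1
    have h4 : 0 < 4 * r := by positivity
    nlinarith
  have h5 : B ^ (-(2 / ν)) * N2 ^ (1 + 1 / ν) ≤ Np := by
    rw [Real.rpow_neg hB.le, inv_mul_le_iff₀ (Real.rpow_pos_of_pos hB _)]
    exact hint.trans (mul_le_mul_of_nonneg_right
      (Real.rpow_le_rpow hN1 hN1B (by positivity)) hNp)
  have h6 : N2 ^ (1 + 2 / ν) * N2 = (N2 ^ (1 + 1 / ν)) ^ 2 := by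
    rw [← Real.rpow_natCast, ← Real.rpow_mul hN2.le]
    nth_rewrite 2 [← Real.rpow_one N2]
    rw [← Real.rpow_add hN2]
    congr 1
    push_cast
    ring
  have h7 : (B ^ (-(2 / ν)) * N2 ^ (1 + 1 / ν)) ^ 2 ≤ Np ^ 2 :=
    pow_le_pow_left₀ (by positivity) h5 2
  refine le_of_mul_le_mul_right ?_ hN2
  calc _ = c ^ 2 * (B ^ (-(2 / ν)) * N2 ^ (1 + 1 / ν)) ^ 2 := by
        rw [mul_assoc, h6]; ring
    _ ≤ c ^ 2 * Np ^ 2 := by gcongr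
    _ ≤ _ := h2

end WeightedMinkowski

namespace CalcGraph

variable {V : Type u} {E : Type w} {G : CalcGraph V E} (hG : G.IsLocallyFinite)

/-! ### Sobolev and Nash inequalities -/

theorem edgesOf_mono {S T : Finset V} (h : S ⊆ T) : edgesOf hG S ⊆ edgesOf hG T := by
  intro e he
  rw [mem_edgesOf] at he ⊢
  exact he.imp (fun h' => h h') (fun h' => h h')

theorem cutEdges_subset {A S : Finset V} (h : A ⊆ S) : cutEdges hG A ⊆ edgesOf hG S := by
  classical exact (Finset.filter_subset _ _).trans (edgesOf_mono hG h)

/-- The functional form of an isoperimetric inequality, by slicing into level sets. -/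
theorem isoperimetric_functional {p i : ℝ} (hp : 1 ≤ p) (hi : 0 ≤ i) (S : Finset V)
    (hcut : ∀ A ⊆ S, i * (∑ v ∈ A, G.vmeas v) ^ (1 / p) ≤ ∑ e ∈ cutEdges hG A, G.weight e)
    (g : V → ℝ) (hg : ∀ v, 0 ≤ g v) (hgS : ∀ v ∉ S, g v = 0) :
    i * (∑ v ∈ S, G.vmeas v * g v ^ p) ^ (1 / p) ≤
      ∑ e ∈ edgesOf hG S, G.weight e * |g (G.src e) - g (G.tgt e)| := by
  classical
  have hp0 : p ≠ 0 := by linarith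
  -- Induction on the number of vertices where `g` is positive.
  induction hn : (S.filter fun v => 0 < g v).card using Nat.strong_induction_on generalizing g with
  | _ n ih =>
  set A := S.filter fun v => 0 < g v with hAdef
  have hgA : ∀ v ∉ A, g v = 0 := by
    intro v hv
    by_cases hvS : v ∈ S
    · by_contra h
      exact hv (Finset.mem_filter.2 ⟨hvS, lt_of_le_of_ne (hg v) (Ne.symm h)⟩)
    · exact hgS v hvS
  rcases A.eq_empty_or_nonempty with hA | hA
  · have h0 : ∀ v, g v = 0 := fun v => hgA v (by rw [hA]; exact Finset.notMem_empty v)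
    simp [h0, Real.zero_rpow hp0, Real.zero_rpow (inv_ne_zero hp0)]
  · obtain ⟨v₀, hv₀, hmin⟩ := Finset.exists_min_image A g hA
    have hAS : A ⊆ S := Finset.filter_subset _ _
    have hc : 0 < g v₀ := (Finset.mem_filter.1 hv₀).2
    set c := g v₀
    -- Peel off the lowest layer: `g = g' + c·1_A`, with `c` the least positive value. The left side
    -- is subadditive by Minkowski, while the variation splits exactly because an edge leaving `A`
    -- loses exactly `c`.
    let g' : V → ℝ := fun v => if v ∈ A then g v - c else 0
    let k : V → ℝ := fun v => if v ∈ A then c else 0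
    have hg' : ∀ v, 0 ≤ g' v := fun v => by
      simp only [g']
      split_ifs with h
      · exact sub_nonneg.2 (hmin v h)
      · rfl
    have hk : ∀ v, 0 ≤ k v := fun v => by
      simp only [k]
      split_ifs with h
      exacts [hc.le, le_rfl]
    have hsum : ∀ v, g v = g' v + k v := fun v => by
      simp only [g', k]
      split_ifs with h
      · ring
      · rw [hgA v h, add_zero]
    have hcard : (S.filter fun v => 0 < g' v).card < n := by
      rw [← hn]
      refine Finset.card_lt_card ⟨fun v hv => ?_, fun h => ?_⟩
      · by_contra hvA
        have := (Finset.mem_filter.1 hv).2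
        simp only [g', if_neg hvA, lt_self_iff_false] at this
      · have := (Finset.mem_filter.1 (h hv₀)).2
        simp [g', if_pos hv₀, c] at this
    have h1 := ih _ hcard g' hg' (fun v hv => if_neg fun h => hv (hAS h)) rfl
    have h2 : (∑ v ∈ S, G.vmeas v * k v ^ p) ^ (1 / p) = c * (∑ v ∈ A, G.vmeas v) ^ (1 / p) := by
      have : ∑ v ∈ S, G.vmeas v * k v ^ p = c ^ p * ∑ v ∈ A, G.vmeas v := by
        rw [Finset.mul_sum, ← Finset.sum_subset hAS]
        · refine Finset.sum_congr rfl fun v hv => ?_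
          simp only [k, if_pos hv]
          ring
        · intro v _ hv
          simp only [k, if_neg hv, Real.zero_rpow hp0, mul_zero]
      rw [this, Real.mul_rpow (Real.rpow_nonneg hc.le _) (Finset.sum_nonneg fun v _ =>
        (G.vmeas_pos v).le), ← Real.rpow_mul hc.le, mul_one_div_cancel hp0, Real.rpow_one]
    have h3 : ∀ e, |g (G.src e) - g (G.tgt e)| = |g' (G.src e) - g' (G.tgt e)| +
        if ¬(G.src e ∈ A ↔ G.tgt e ∈ A) then c else 0 := by
      intro e
      simp only [g']
      by_cases hs : G.src e ∈ A <;> by_cases ht : G.tgt e ∈ A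
      · simp [hs, ht]
      · have := hmin _ hs
        simp only [hs, ht, hgA _ ht, if_true, if_false, sub_zero, iff_false, not_true,
          not_false_iff]
        rw [abs_of_nonneg (hg _), abs_of_nonneg (by linarith)]
        ring
      · have := hmin _ ht
        simp only [hs, ht, hgA _ hs, if_true, if_false, zero_sub, abs_neg, iff_true,
          not_false_iff]
        rw [abs_of_nonneg (hg _), abs_of_nonneg (by linarith)]
        ring
      · simp [hs, ht, hgA _ hs, hgA _ ht]
    have h4 : ∑ e ∈ edgesOf hG S, G.weight e * (if ¬(G.src e ∈ A ↔ G.tgt e ∈ A) then c else 0) =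
        c * ∑ e ∈ cutEdges hG A, G.weight e := by
      rw [Finset.mul_sum, ← Finset.sum_subset (cutEdges_subset hG hAS)]
      · refine Finset.sum_congr rfl fun e he => ?_
        rw [if_pos ((mem_cutEdges hG).1 he), mul_comm]
      · intro e _ he
        rw [mem_cutEdges] at he
        rw [if_neg he, mul_zero]
    have h5 := Real.weighted_Lp_add_le S G.vmeas g' k hp (fun v => (G.vmeas_pos v).le) hg' hk
    simp_rw [h3, mul_add]
    rw [Finset.sum_add_distrib, h4]
    simp_rw [← hsum] at h5
    calc _ ≤ i * ((∑ v ∈ S, G.vmeas v * g' v ^ p) ^ (1 / p) +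
          (∑ v ∈ S, G.vmeas v * k v ^ p) ^ (1 / p)) := mul_le_mul_of_nonneg_left h5 hi
      _ = i * (∑ v ∈ S, G.vmeas v * g' v ^ p) ^ (1 / p) +
          c * (i * (∑ v ∈ A, G.vmeas v) ^ (1 / p)) := by rw [h2]; ring
      _ ≤ _ := add_le_add h1 (mul_le_mul_of_nonneg_left (hcut A hAS) hc.le)

/-- The Dirichlet energy of a function supported in `S`. -/
noncomputable def energy (hG : G.IsLocallyFinite) (S : Finset V) (f : V → ℝ) : ℝ :=
  ∑ e ∈ edgesOf hG S, G.weight e / G.len e * (f (G.src e) - f (G.tgt e)) ^ 2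

theorem energy_nonneg (S : Finset V) (f : V → ℝ) : 0 ≤ energy hG S f :=
  Finset.sum_nonneg fun e _ => mul_nonneg (coeff_pos G e).le (sq_nonneg _)

/-- A bound for the total variation of `f²`. -/
noncomputable def sqVariation (hG : G.IsLocallyFinite) (S : Finset V) (f : V → ℝ) : ℝ :=
  ∑ e ∈ edgesOf hG S, G.weight e *
    (|f (G.src e) - f (G.tgt e)| * (|f (G.src e)| + |f (G.tgt e)|))

/-- Cauchy–Schwarz with edge weights `a/ℓ` and `aℓ`, then `(|x| + |y|)² ≤ 2(x² + y²)`. Regrouping by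
vertices gives `4 f(v)²` times the sum of `aℓ/2` over the edges at `v`, which `ρ_sup` controls. -/
theorem sqVariation_sq_le {r : ℝ} (hr : 0 ≤ r) (hρ : G.rhoSup ≤ ENNReal.ofReal r) (S : Finset V)
    (f : V → ℝ) (hf : ∀ v ∉ S, f v = 0) :
    sqVariation hG S f ^ 2 ≤ energy hG S f * (4 * r * ∑ v ∈ S, G.vmeas v * f v ^ 2) := by
  classical
  -- Self-loops are dropped: they contribute nothing to the variation, and the half-degree counts
  -- them once, too little for the estimate with two endpoints.
  let h : E → ℝ := fun e => if G.src e = G.tgt e then 0 else |f (G.src e)| + |f (G.tgt e)|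
  have hwl : ∀ e, 0 < G.weight e * G.len e := fun e => mul_pos (G.weight_pos e) (G.len_pos e)
  have h1 := Finset.sum_sq_le_sum_mul_sum_of_sq_le_mul (edgesOf hG S)
    (r := fun e => G.weight e *
      (|f (G.src e) - f (G.tgt e)| * (|f (G.src e)| + |f (G.tgt e)|)))
    (f := fun e => G.weight e / G.len e * (f (G.src e) - f (G.tgt e)) ^ 2)
    (g := fun e => G.weight e * G.len e * h e ^ 2)
    (fun e _ => mul_nonneg (coeff_pos G e).le (sq_nonneg _))
    (fun e _ => mul_nonneg (hwl e).le (sq_nonneg _)) (fun e _ => by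
      have hl := (G.len_pos e).ne'
      by_cases he : G.src e = G.tgt e
      · simp [h, he]
      · simp only [h, if_neg he]
        rw [mul_pow, mul_pow, sq_abs]
        refine le_of_eq ?_
        field_simp)
  refine h1.trans (mul_le_mul_of_nonneg_left ?_ (energy_nonneg hG S f))
  have key : ∀ (x : V), ∑ v ∈ S, (if x = v then f v ^ 2 else 0) = f x ^ 2 := by
    intro x
    rw [Finset.sum_ite_eq]
    split_ifs with hx
    · rfl
    · rw [hf x hx]; norm_num
  have h2 : ∀ e, G.weight e * G.len e * h e ^ 2 ≤
      ∑ v ∈ S, if e ∈ (hG v).toFinset then 4 * f v ^ 2 * (G.weight e * G.len e / 2) else 0 := by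
    intro e
    by_cases he : G.src e = G.tgt e
    · simp only [h, if_pos he]
      rw [zero_pow two_ne_zero, mul_zero]
      refine Finset.sum_nonneg fun v _ => ?_
      split_ifs
      · have := hwl e; positivity
      · rfl
    · have e1 : ∀ v, (if e ∈ (hG v).toFinset then 4 * f v ^ 2 * (G.weight e * G.len e / 2) else 0) =
          G.weight e * G.len e * (2 * ((if G.src e = v then f v ^ 2 else 0) +
            if G.tgt e = v then f v ^ 2 else 0)) := by
        intro v
        have : e ∈ (hG v).toFinset ↔ G.src e = v ∨ G.tgt e = v := by
          rw [Finite.mem_toFinset]; rfl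
        rw [if_congr this rfl rfl]
        by_cases h3 : G.src e = v
        · have h4 : G.tgt e ≠ v := fun h4 => he (h3.trans h4.symm)
          simp only [h3, h4, true_or, if_true, if_false]
          ring
        · by_cases h4 : G.tgt e = v
          · simp only [h3, h4, or_true, if_true, if_false]
            ring
          · simp [h3, h4]
      simp_rw [e1]
      rw [← Finset.mul_sum, ← Finset.mul_sum, Finset.sum_add_distrib, key, key]
      refine mul_le_mul_of_nonneg_left ?_ (hwl e).le
      simp only [h, if_neg he]
      rw [← sq_abs (f (G.src e)), ← sq_abs (f (G.tgt e))]
      nlinarith [sq_nonneg (|f (G.src e)| - |f (G.tgt e)|)]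
  refine (Finset.sum_le_sum fun e _ => h2 e).trans ?_
  rw [Finset.sum_comm, Finset.mul_sum]
  refine Finset.sum_le_sum fun v hv => ?_
  rw [← Finset.sum_filter, ← Finset.mul_sum]
  have h5 : (edgesOf hG S).filter (fun e => e ∈ (hG v).toFinset) = (hG v).toFinset := by
    ext e
    rw [Finset.mem_filter, Finite.mem_toFinset, mem_edgesOf]
    refine ⟨fun h => h.2, fun h => ⟨?_, h⟩⟩
    rcases h with rfl | rfl
    exacts [Or.inl hv, Or.inr hv]
  rw [h5]
  have := mul_le_mul_of_nonneg_left (sum_edge_le_of_rhoSup_le hG hr hρ v)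
    (by positivity : 0 ≤ 4 * f v ^ 2)
  linarith

theorem one_div_conj {ν : ℝ} (hν : 1 < ν) : 1 / (ν / (ν - 1)) = 1 - 1 / ν := by
  have h1 : ν - 1 ≠ 0 := by linarith
  have h0 : ν ≠ 0 := by linarith
  field_simp

theorem one_le_conj {ν : ℝ} (hν : 1 < ν) : 1 ≤ ν / (ν - 1) := by
  rw [le_div_iff₀ (by linarith)]
  linarith

/-- The Nash inequality for functions with finite support in the interior. -/
theorem nash_inequality {ν c r : ℝ} (hν : 1 < ν) (hc : 0 < c) (hr : 0 < r)
    (hρ : G.rhoSup ≤ ENNReal.ofReal r) (hI : ENNReal.ofReal (2 * c * √r) ≤ G.isoConst ν)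
    (S : Finset V) (hS : ∀ v ∈ S, v ∉ G.boundary) (f : V → ℝ) (hf : ∀ v ∉ S, f v = 0)
    (h1 : ∑ v ∈ S, G.vmeas v * |f v| ≤ 1) :
    c ^ 2 * (∑ v ∈ S, G.vmeas v * f v ^ 2) ^ (1 + 2 / ν) ≤ energy hG S f := by
  have hm : ∀ v, 0 ≤ G.vmeas v := fun v => (G.vmeas_pos v).le
  have hiso := isoperimetric_functional hG (one_le_conj hν) (i := 2 * c * √r) (by positivity) S
    (fun A hA => by
      rw [one_div_conj hν]
      exact isoConst_mul_le hG hν hI fun v hv => hS v (hA hv))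
    (fun v => f v ^ 2) (fun v => sq_nonneg _) (fun v hv => by rw [hf v hv]; norm_num)
  rw [one_div_conj hν] at hiso
  have := nash_of_sobolev (B := 1) (by linarith) hc hr one_pos
    (Finset.sum_nonneg fun v _ => mul_nonneg (hm v) (abs_nonneg _)) h1
    (Finset.sum_nonneg fun v _ => mul_nonneg (hm v) (sq_nonneg (f v)))
    (Real.rpow_nonneg (Finset.sum_nonneg fun v _ =>
      mul_nonneg (hm v) (Real.rpow_nonneg (sq_nonneg _) _)) _) (energy_nonneg hG S f)
    (Real.weighted_interpolation S G.vmeas f hν G.vmeas_pos)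
    (hiso.trans (Finset.sum_le_sum fun e _ => mul_le_mul_of_nonneg_left ?_ (G.weight_pos e).le))
    (sqVariation_sq_le hG hr.le hρ S f hf)
  · simpa using this
  · rw [sq_sub_sq, abs_mul, mul_comm]
    exact mul_le_mul_of_nonneg_left (abs_add_le _ _) (abs_nonneg _)

/-- The Nash inequality for functions of mean zero on a closed graph. -/
theorem nash_inequality_closed [Fintype V] [Nonempty V] (hb : G.boundary = ∅) {ν c r : ℝ}
    (hν : 1 < ν) (hc : 0 < c) (hr : 0 < r) (hρ : G.rhoSup ≤ ENNReal.ofReal r)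
    (hI : ENNReal.ofReal (2 * c * √r) ≤ G.isoConstClosed ν) (f : V → ℝ)
    (h0 : ∑ v, G.vmeas v * f v = 0) (h1 : ∑ v, G.vmeas v * |f v| ≤ 2) :
    ((2 : ℝ) ^ (-(2 / ν)) * c) ^ 2 * (∑ v, G.vmeas v * f v ^ 2) ^ (1 + 2 / ν) ≤
      energy hG Finset.univ f := by
  classical
  have hm : ∀ v, 0 ≤ G.vmeas v := fun v => (G.vmeas_pos v).le
  have hν0 : 0 < ν := by linarith
  obtain ⟨k, hk1, hk2⟩ := exists_weighted_median G.vmeas f hm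
  let g : V → ℝ := fun v => f v - k
  have hen : energy hG Finset.univ f = energy hG Finset.univ g := by
    simp only [energy, g, sub_sub_sub_cancel_right]
  -- Every subset of a set with at most half the volume is the smaller side of its cut, so the
  -- closed isoperimetric inequality applies to all its subsets.
  have hpart : ∀ (φ : V → ℝ) (A : Finset V), (∀ v, 0 ≤ φ v) → (∀ v ∉ A, φ v = 0) →
      2 * ∑ v ∈ A, G.vmeas v ≤ ∑ v, G.vmeas v →
      2 * c * √r * (∑ v, G.vmeas v * φ v ^ (ν / (ν - 1))) ^ (1 - 1 / ν) ≤
        ∑ e ∈ edgesOf hG Finset.univ, G.weight e * |φ (G.src e) - φ (G.tgt e)| := by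
    intro φ A hφ hφA hA
    have hiso := isoperimetric_functional hG (one_le_conj hν) (i := 2 * c * √r) (by positivity) A
      (fun A' hA' => by
        rw [one_div_conj hν]
        refine isoConstClosed_mul_le hG hb hν hI ?_
        have e1 := Finset.sum_le_sum_of_subset_of_nonneg (f := G.vmeas) hA' fun v _ _ => hm v
        have e2 := Finset.sum_add_sum_compl A' G.vmeas
        linarith) φ hφ hφA
    rw [one_div_conj hν] at hiso
    have hp0 : ν / (ν - 1) ≠ 0 := by have := one_le_conj hν; linarith
    rw [Finset.sum_subset (Finset.subset_univ A) fun v _ hv => by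
      rw [hφA v hv, Real.zero_rpow hp0, mul_zero]] at hiso
    exact hiso.trans (Finset.sum_le_sum_of_subset_of_nonneg
      (edgesOf_mono hG (Finset.subset_univ A)) fun e _ _ =>
      mul_nonneg (G.weight_pos e).le (abs_nonneg _))
  have hpos := hpart (fun v => (max (g v) 0) ^ 2) (Finset.univ.filter fun v => k < f v)
    (fun v => sq_nonneg _) (fun v hv => by
      have : g v ≤ 0 := by simpa [g] using hv
      simp [max_eq_right this]) hk1
  have hneg := hpart (fun v => (max (-g v) 0) ^ 2) (Finset.univ.filter fun v => f v < k)
    (fun v => sq_nonneg _) (fun v hv => by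
      have : -g v ≤ 0 := by simpa [g] using hv
      simp only [max_eq_right this]
      norm_num) hk2
  have hsq : ∀ v, g v ^ 2 = (max (g v) 0) ^ 2 + (max (-g v) 0) ^ 2 := fun v => by
    rcases le_total (g v) 0 with h | h
    · rw [max_eq_right h, max_eq_left (neg_nonneg.2 h)]; ring
    · rw [max_eq_left h, max_eq_right (neg_nonpos.2 h)]; ring
  have hsob : 2 * c * √r * (∑ v, G.vmeas v * (g v ^ 2) ^ (ν / (ν - 1))) ^ (1 - 1 / ν) ≤
      sqVariation hG Finset.univ g := by
    have hmink := Real.weighted_Lp_add_le Finset.univ G.vmeas (fun v => (max (g v) 0) ^ 2)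
      (fun v => (max (-g v) 0) ^ 2) (one_le_conj hν) hm (fun v => sq_nonneg _) fun v => sq_nonneg _
    rw [one_div_conj hν] at hmink
    simp_rw [← hsq] at hmink
    refine (mul_le_mul_of_nonneg_left hmink (by positivity)).trans ?_
    rw [mul_add]
    refine (add_le_add hpos hneg).trans ?_
    rw [← Finset.sum_add_distrib]
    refine Finset.sum_le_sum fun e _ => ?_
    rw [← mul_add]
    refine mul_le_mul_of_nonneg_left ?_ (G.weight_pos e).le
    -- For `a`, `b` of opposite sign the left side is `a² + b²` and the right side is `(|a| +
    -- |b|)²`; for equal signs only one term on the left survives.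
    have aux : ∀ a b : ℝ, |max a 0 ^ 2 - max b 0 ^ 2| + |max (-a) 0 ^ 2 - max (-b) 0 ^ 2| ≤
        |a - b| * (|a| + |b|) := by
      intro a b
      rcases le_total a 0 with ha | ha <;> rcases le_total b 0 with hb | hb
      · rw [max_eq_right ha, max_eq_right hb, max_eq_left (neg_nonneg.2 ha),
          max_eq_left (neg_nonneg.2 hb), sub_self, abs_zero, zero_add, neg_sq, neg_sq, sq_sub_sq,
          abs_mul, mul_comm]
        exact mul_le_mul_of_nonneg_left (abs_add_le _ _) (abs_nonneg _)
      · rw [max_eq_right ha, max_eq_left hb, max_eq_left (neg_nonneg.2 ha),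
          max_eq_right (neg_nonpos.2 hb), abs_of_nonpos ha, abs_of_nonneg hb,
          abs_of_nonpos (by linarith : a - b ≤ 0), abs_of_nonpos (by nlinarith),
          abs_of_nonneg (by nlinarith)]
        nlinarith
      · rw [max_eq_left ha, max_eq_right hb, max_eq_right (neg_nonpos.2 ha),
          max_eq_left (neg_nonneg.2 hb), abs_of_nonneg ha, abs_of_nonpos hb,
          abs_of_nonneg (by linarith : 0 ≤ a - b), abs_of_nonneg (by nlinarith),
          abs_of_nonpos (by nlinarith)]
        nlinarith
      · rw [max_eq_left ha, max_eq_left hb, max_eq_right (neg_nonpos.2 ha),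
          max_eq_right (neg_nonpos.2 hb), sub_self, abs_zero, add_zero, sq_sub_sq,
          abs_mul, mul_comm]
        exact mul_le_mul_of_nonneg_left (abs_add_le _ _) (abs_nonneg _)
    exact aux _ _
  -- Since `f` has mean zero, subtracting a constant can only increase the `L²` norm.
  have hN2 : ∑ v, G.vmeas v * f v ^ 2 ≤ ∑ v, G.vmeas v * g v ^ 2 := by
    have : ∑ v, G.vmeas v * g v ^ 2 = ∑ v, G.vmeas v * f v ^ 2 - 2 * k * ∑ v, G.vmeas v * f v +
        k ^ 2 * ∑ v, G.vmeas v := by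
      rw [Finset.mul_sum, Finset.mul_sum, ← Finset.sum_sub_distrib, ← Finset.sum_add_distrib]
      exact Finset.sum_congr rfl fun v _ => by simp only [g]; ring
    rw [this, h0]
    have := mul_nonneg (sq_nonneg k) (Finset.sum_nonneg fun v (_ : v ∈ Finset.univ) => hm v)
    linarith
  have := nash_of_sobolev (B := 2) hν0 hc hr two_pos
    (Finset.sum_nonneg fun v _ => mul_nonneg (hm v) (abs_nonneg _))
    ((sum_abs_sub_median_le G.vmeas f hm hk1 hk2).trans h1)
    (Finset.sum_nonneg fun v _ => mul_nonneg (hm v) (sq_nonneg (g v)))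
    (Real.rpow_nonneg (Finset.sum_nonneg fun v _ =>
      mul_nonneg (hm v) (Real.rpow_nonneg (sq_nonneg _) _)) _) (energy_nonneg hG Finset.univ g)
    (Real.weighted_interpolation Finset.univ G.vmeas g hν G.vmeas_pos) hsob
    (sqVariation_sq_le hG hr.le hρ Finset.univ g fun v hv => absurd (Finset.mem_univ v) hv)
  rw [hen]
  refine le_trans ?_ this
  refine mul_le_mul_of_nonneg_left (Real.rpow_le_rpow (Finset.sum_nonneg fun v _ =>
    mul_nonneg (hm v) (sq_nonneg (f v))) hN2 (by positivity)) (sq_nonneg _)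

end CalcGraph

/-! ### Integration of Nash's differential inequality and degenerate values of the constants -/

section Constants

open Filter Topology

/-- Integration of the differential inequality `ψ' ≤ -c² ψ^{1 + 2/ν}`. -/
theorem le_rpow_of_deriv_le {ψ d : ℝ → ℝ} {ν c t : ℝ} (hν : 0 < ν) (hc : 0 < c) (ht : 0 < t)
    (hd : ∀ s, 0 ≤ s → HasDerivAt ψ (d s) s) (h0 : ∀ s, 0 ≤ s → 0 ≤ ψ s)
    (hle : ∀ s, 0 ≤ s → c ^ 2 * ψ s ^ (1 + 2 / ν) ≤ -d s) :
    ψ t ≤ (ν / 2) ^ (ν / 2) * c ^ (-ν) * t ^ (-(ν / 2)) := by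
  rcases (h0 t ht.le).eq_or_lt with hz | hpos
  · rw [← hz]; positivity
  have hanti : AntitoneOn ψ (Ici 0) := by
    refine antitoneOn_of_deriv_nonpos (convex_Ici 0)
      (fun s hs => (hd s hs).continuousAt.continuousWithinAt)
      (fun s hs => (hd s (interior_subset hs)).differentiableAt.differentiableWithinAt) ?_
    intro s hs
    have hs' : 0 ≤ s := interior_subset hs
    rw [(hd s hs').deriv]
    have := hle s hs'
    have h2 : 0 ≤ c ^ 2 * ψ s ^ (1 + 2 / ν) :=
      mul_nonneg (sq_nonneg c) (Real.rpow_nonneg (h0 s hs') _)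
    linarith
  have hps : ∀ s ∈ Icc 0 t, 0 < ψ s := fun s hs => hpos.trans_le (hanti hs.1 ht.le hs.2)
  have hFd : ∀ s ∈ Icc 0 t, HasDerivAt (fun s => ψ s ^ (-(2 / ν)) - 2 * c ^ 2 / ν * s)
      (d s * (-(2 / ν)) * ψ s ^ (-(2 / ν) - 1) - 2 * c ^ 2 / ν) s := fun s hs => by
    simpa using ((hd s hs.1).rpow_const (p := -(2 / ν)) (Or.inl (hps s hs).ne')).fun_sub
      ((hasDerivAt_id' s).const_mul (2 * c ^ 2 / ν))
  -- `ψ^{-2/ν}` grows at rate at least `2c²/ν`; positivity on `[0, t]` makes the negative power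
  -- differentiable.
  have hmono : MonotoneOn (fun s => ψ s ^ (-(2 / ν)) - 2 * c ^ 2 / ν * s) (Icc 0 t) := by
    refine monotoneOn_of_deriv_nonneg (convex_Icc 0 t)
      (fun s hs => (hFd s hs).continuousAt.continuousWithinAt)
      (fun s hs => (hFd s (interior_subset hs)).differentiableAt.differentiableWithinAt) ?_
    intro s hs
    have hs' : s ∈ Icc 0 t := interior_subset hs
    rw [(hFd s hs').deriv]
    have h1 := hle s hs'.1
    have h2 : ψ s ^ (1 + 2 / ν) * ψ s ^ (-(2 / ν) - 1) = 1 := by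
      rw [← Real.rpow_add (hps s hs')]
      ring_nf
      exact Real.rpow_zero _
    have h3 : 0 < ψ s ^ (-(2 / ν) - 1) := Real.rpow_pos_of_pos (hps s hs') _
    have h4 : c ^ 2 ≤ -d s * ψ s ^ (-(2 / ν) - 1) := by
      have := mul_le_mul_of_nonneg_right h1 h3.le
      rwa [mul_assoc, h2, mul_one] at this
    have h5 : 0 < 2 / ν := by positivity
    have := mul_le_mul_of_nonneg_left h4 h5.le
    have h6 : 2 * c ^ 2 / ν = 2 / ν * c ^ 2 := by ring
    rw [h6]
    linarith
  have hfin := hmono ⟨le_rfl, ht.le⟩ ⟨ht.le, le_rfl⟩ ht.le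
  simp only [mul_zero, sub_zero] at hfin
  have hlow : 2 * c ^ 2 / ν * t ≤ ψ t ^ (-(2 / ν)) := by
    have := Real.rpow_nonneg (h0 0 le_rfl) (-(2 / ν))
    linarith
  have hexp : (ψ t ^ (-(2 / ν))) ^ (-(ν / 2)) = ψ t := by
    rw [← Real.rpow_mul hpos.le]
    have : -(2 / ν) * -(ν / 2) = 1 := by field_simp
    rw [this, Real.rpow_one]
  have hcst : (2 * c ^ 2 / ν * t) ^ (-(ν / 2)) =
      (ν / 2) ^ (ν / 2) * c ^ (-ν) * t ^ (-(ν / 2)) := by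
    rw [Real.mul_rpow (by positivity) ht.le]
    congr 1
    have : 2 * c ^ 2 / ν = (ν / 2)⁻¹ * c ^ (2 : ℝ) := by
      rw [Real.rpow_two]; field_simp
    rw [this, Real.mul_rpow (by positivity) (by positivity), ← Real.rpow_mul hc.le,
      Real.inv_rpow (by positivity), Real.rpow_neg (by positivity), inv_inv]
    congr 2
    ring
  rw [← hexp, ← hcst]
  exact Real.rpow_le_rpow_of_nonpos (by positivity) hlow (by linarith)

/-- Reduction to finite positive constants. For `C = 0` the right side is infinite, for `C = ∞`
letting `c → ∞` forces `k ≤ 0`, and otherwise `c = C` is allowed. -/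
theorem ofReal_le_nashC₂_mul {ν t k : ℝ} {C : ℝ≥0∞} (hν : 0 < ν) (ht : 0 < t)
    (h : ∀ c : ℝ, 0 < c → ENNReal.ofReal c ≤ C →
      k ≤ (ν / 2) ^ (ν / 2) * c ^ (-ν) * t ^ (-(ν / 2))) :
    ENNReal.ofReal k ≤ nashC₂ ν C * ENNReal.ofReal t ^ (-(ν / 2)) := by
  have hν2 : 0 < ν / 2 := by positivity
  have htp : ENNReal.ofReal t ^ (-(ν / 2)) = ENNReal.ofReal (t ^ (-(ν / 2))) :=
    ENNReal.ofReal_rpow_of_pos ht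
  have hνp : ENNReal.ofReal (ν / 2) ^ (ν / 2) = ENNReal.ofReal ((ν / 2) ^ (ν / 2)) :=
    ENNReal.ofReal_rpow_of_pos hν2
  have ht0 := Real.rpow_pos_of_pos ht (-(ν / 2))
  have hν0 := Real.rpow_pos_of_pos hν2 (ν / 2)
  rw [nashC₂, htp, hνp]
  rcases eq_or_ne C 0 with rfl | hC0
  · rw [ENNReal.zero_rpow_of_neg (by linarith), ENNReal.mul_top (ENNReal.ofReal_pos.2 hν0).ne',
      ENNReal.top_mul (ENNReal.ofReal_pos.2 ht0).ne']
    exact le_top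
  rcases eq_or_ne C ⊤ with rfl | hCt
  · have hk : k ≤ 0 := by
      have hlim : Tendsto (fun c : ℝ => (ν / 2) ^ (ν / 2) * c ^ (-ν) * t ^ (-(ν / 2))) atTop
          (𝓝 ((ν / 2) ^ (ν / 2) * 0 * t ^ (-(ν / 2)))) :=
        ((tendsto_rpow_neg_atTop hν).const_mul _).mul_const _
      rw [mul_zero, zero_mul] at hlim
      refine ge_of_tendsto hlim ?_
      filter_upwards [eventually_gt_atTop 0] with c hc
      exact h c hc le_top
    rw [ENNReal.ofReal_of_nonpos hk]
    exact zero_le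
  · have hc : 0 < C.toReal := ENNReal.toReal_pos hC0 hCt
    have := h C.toReal hc (ENNReal.ofReal_toReal hCt).le
    rw [← ENNReal.ofReal_toReal hCt, ENNReal.ofReal_rpow_of_pos hc, ← ENNReal.ofReal_mul hν0.le,
      ← ENNReal.ofReal_mul (mul_nonneg hν0.le (Real.rpow_nonneg hc.le _))]
    exact ENNReal.ofReal_le_ofReal this

/-- The Nash argument needs a finite positive bound `r` for `ρ`. Positivity of `c` excludes `I = 0`
and `ρ = ∞`. If `ρ = 0`, any `r > 0` bounds it, and for finite `I` the choice `r = (I/(2c))²` makes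
the second inequality an equality. -/
theorem exists_pos_of_ofReal_le {c : ℝ} (hc : 0 < c) {I ρ : ℝ≥0∞}
    (h : ENNReal.ofReal c ≤ I * ρ ^ (-(1 / 2) : ℝ) / 2) :
    ∃ r : ℝ, 0 < r ∧ ρ ≤ ENNReal.ofReal r ∧ ENNReal.ofReal (2 * c * √r) ≤ I := by
  have hc' : ENNReal.ofReal c ≠ 0 := (ENNReal.ofReal_pos.2 hc).ne'
  have hI0 : I ≠ 0 := by
    rintro rfl
    rw [zero_mul, ENNReal.zero_div] at h
    exact hc' (le_antisymm h zero_le)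
  have hρt : ρ ≠ ⊤ := by
    rintro rfl
    rw [ENNReal.top_rpow_of_neg (by norm_num), mul_zero, ENNReal.zero_div] at h
    exact hc' (le_antisymm h zero_le)
  rcases eq_or_ne ρ 0 with rfl | hρ0
  · rcases eq_or_ne I ⊤ with rfl | hIt
    · exact ⟨1, one_pos, zero_le, le_top⟩
    · have hi : 0 < I.toReal := ENNReal.toReal_pos hI0 hIt
      refine ⟨(I.toReal / (2 * c)) ^ 2, by positivity, zero_le, ?_⟩
      rw [Real.sqrt_sq (by positivity), mul_div_cancel₀ _ (by positivity : 2 * c ≠ 0),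
        ENNReal.ofReal_toReal hIt]
  · have hr : 0 < ρ.toReal := ENNReal.toReal_pos hρ0 hρt
    refine ⟨ρ.toReal, hr, (ENNReal.ofReal_toReal hρt).ge, ?_⟩
    rcases eq_or_ne I ⊤ with rfl | hIt
    · exact le_top
    have hi : 0 < I.toReal := ENNReal.toReal_pos hI0 hIt
    have h2 : (2 : ℝ≥0∞) = ENNReal.ofReal 2 := by simp
    rw [← ENNReal.ofReal_toReal hρt, ← ENNReal.ofReal_toReal hIt, ENNReal.ofReal_rpow_of_pos hr,
      ← ENNReal.ofReal_mul hi.le, h2, ← ENNReal.ofReal_div_of_pos two_pos,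
      ENNReal.ofReal_le_ofReal_iff (by positivity), Real.rpow_neg hr.le, ← Real.sqrt_eq_rpow] at h
    rw [← ENNReal.ofReal_toReal hIt]
    refine ENNReal.ofReal_le_ofReal ?_
    have hs := Real.sqrt_pos.2 hr
    rw [le_div_iff₀ two_pos, ← div_eq_mul_inv, le_div_iff₀ hs] at h
    linarith

end Constants

namespace CalcGraph

variable {V : Type u} {E : Type w} {G : CalcGraph V E} (hG : G.IsLocallyFinite)

/-! ### The heat kernel bounds -/

include hG in
theorem finKernel_diag_eq (S : Finset V) (y : V) (t : ℝ) :
    G.finKernel S y y t = ∑ v ∈ S, G.vmeas v * G.finKernel S v y (t / 2) ^ 2 := by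
  rw [← add_halves t, finKernel_add, add_halves]
  refine Finset.sum_congr rfl fun v _ => ?_
  rw [finKernel_symm hG y v]
  ring

/-- The semigroup identity at half times followed by Green's formula. The left side is minus the
time derivative of the diagonal. -/
theorem lap_finKernel_diag_eq {S : Finset V} {y : V} (hy : y ∈ S) (t : ℝ) :
    G.lap (fun w => G.finKernel S w y t) y =
      energy hG S fun v => G.finKernel S v y (t / 2) := by
  conv_lhs => rw [← add_halves t]
  rw [lap_finKernel_add hG hy]
  have := sum_mul_lap hG S (fun v => G.finKernel S v y (t / 2))
    (fun v => G.finKernel S v y (t / 2)) fun v hv => finKernel_of_left hv y _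
  rw [energy]
  simp_rw [pow_two]
  rw [← this]
  refine Finset.sum_congr rfl fun v _ => ?_
  rw [finKernel_symm hG y v]
  ring

include hG in
theorem sum_vmeas_mul_finKernel_le_one (S : Finset V) (y : V) {t : ℝ} (ht : 0 ≤ t) :
    ∑ v ∈ S, G.vmeas v * G.finKernel S v y t ≤ 1 := by
  refine le_of_eq_of_le (Finset.sum_congr rfl fun v _ => ?_) (sum_finKernel_le_one hG y ht)
  rw [finKernel_symm hG v y, mul_comm]

include hG in
theorem finKernel_diag_le {ν c : ℝ} (hν : 1 < ν) (hc : 0 < c)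
    (h : ENNReal.ofReal c ≤ G.nashC₁ ν) (S : Finset V) (hS : ∀ v ∈ S, v ∉ G.boundary) (y : V)
    {t : ℝ} (ht : 0 < t) :
    G.finKernel S y y t ≤ (ν / 2) ^ (ν / 2) * c ^ (-ν) * t ^ (-(ν / 2)) := by
  by_cases hy : y ∈ S
  · obtain ⟨r, hr, hρ, hI⟩ := exists_pos_of_ofReal_le hc h
    refine le_rpow_of_deriv_le (by linarith) hc ht (fun s _ => hasDerivAt_finKernel hG hy y s)
      (fun s hs => finKernel_nonneg hG y y hs) fun s hs => ?_
    rw [neg_neg, lap_finKernel_diag_eq hG hy, finKernel_diag_eq hG]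
    refine nash_inequality hG hν hc hr hρ hI S hS _ (fun v hv => finKernel_of_left hv y _) ?_
    refine le_of_eq_of_le (Finset.sum_congr rfl fun v _ => ?_)
      (sum_vmeas_mul_finKernel_le_one hG S y (div_nonneg hs zero_le_two))
    rw [abs_of_nonneg (finKernel_nonneg hG v y (div_nonneg hs zero_le_two))]
  · rw [finKernel_of_left hy]
    have : 0 < ν := by linarith
    positivity

include hG in
theorem vKernel_diag_le {ν c : ℝ} (hν : 1 < ν) (hc : 0 < c)
    (h : ENNReal.ofReal c ≤ G.nashC₁ ν) (y : V) {t : ℝ} (ht : 0 < t) :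
    G.vKernel y y t ≤ (ν / 2) ^ (ν / 2) * c ^ (-ν) * t ^ (-(ν / 2)) :=
  ciSup_le fun _ => finKernel_diag_le hG hν hc h _ (fun _ hv => (mem_interiorPart.1 hv).2) y ht

include hG in
/-- The diagonal of the heat kernel is largest at vertices. -/
theorem minKernel_diag_le {k t : ℝ} (ht : 0 ≤ t) (h : ∀ v, G.vKernel v v t ≤ k)
    (x : G.Realization) : G.minKernel x x t ≤ k := by
  obtain ⟨u, v, a, b, ha, hb, hab, hx⟩ := G.exists_lin_eq x
  have hs : ∀ u v, HasSum (fun w => G.vKernel u w (t / 2) * G.vKernel w v (t / 2) * G.vmeas w)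
      (G.vKernel u v t) := fun u v => by
    simpa using hasSum_vKernel hG u v (div_nonneg ht zero_le_two) (div_nonneg ht zero_le_two)
  -- The second difference is the squared `ℓ²(𝒱)` distance between the kernels at time `t/2` based
  -- at `u` and at `v`.
  have hnn : 0 ≤ G.vKernel u u t - 2 * G.vKernel u v t + G.vKernel v v t := by
    refine (((hs u u).sub ((hs u v).mul_left 2)).add (hs v v)).nonneg fun w => ?_
    have e : G.vKernel u w (t / 2) * G.vKernel w u (t / 2) * G.vmeas w -
        2 * (G.vKernel u w (t / 2) * G.vKernel w v (t / 2) * G.vmeas w) +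
        G.vKernel v w (t / 2) * G.vKernel w v (t / 2) * G.vmeas w =
        (G.vKernel u w (t / 2) - G.vKernel v w (t / 2)) ^ 2 * G.vmeas w := by
      rw [vKernel_symm hG w u, vKernel_symm hG w v]
      ring
    rw [e]
    exact mul_nonneg (sq_nonneg _) (G.vmeas_pos w).le
  simp only [minKernel, hx]
  rw [vKernel_symm hG v u]
  have h1 := h u
  have h2 := h v
  have hb' : b = 1 - a := by linarith
  subst hb'
  -- With `a + b = 1`, the diagonal value at `x` is `a K(u,u) + b K(v,v)` minus `ab` times the
  -- second difference.
  nlinarith [mul_nonneg ha hb, mul_le_mul_of_nonneg_left h1 ha, mul_le_mul_of_nonneg_left h2 hb]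

/-! ### Closed graphs: conservation of mass and convergence to equilibrium -/

section Closed

variable [Fintype V]

include hG in
-- Green's formula against the constant `1` shows that mass is conserved; it equals `1` at time `0`.
theorem sum_vmeas_mul_finKernel_univ (y : V) (t : ℝ) :
    ∑ v, G.vmeas v * G.finKernel Finset.univ v y t = 1 := by
  classical
  have hd : ∀ t, HasDerivAt (fun t => ∑ v, G.vmeas v * G.finKernel Finset.univ v y t) 0 t := by
    intro t
    have h1 : HasDerivAt (fun t => ∑ v, G.vmeas v * G.finKernel Finset.univ v y t)
        (∑ v, G.vmeas v * -G.lap (fun w => G.finKernel Finset.univ w y t) v) t :=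
      HasDerivAt.fun_sum fun v _ =>
        (hasDerivAt_finKernel hG (Finset.mem_univ v) y t).const_mul _
    refine h1.congr_deriv ?_
    have h2 := sum_mul_lap hG Finset.univ (fun w => G.finKernel Finset.univ w y t) (fun _ => 1)
      fun v hv => absurd (Finset.mem_univ v) hv
    simpa using h2
  have := is_const_of_deriv_eq_zero (fun t => (hd t).differentiableAt) (fun t => (hd t).deriv) t 0
  rw [this]
  simp [finKernel_zero, (G.vmeas_pos y).ne']

include hG in
theorem finKernel_univ_diag_sub_le (hb : G.boundary = ∅) {ν c : ℝ} (hν : 1 < ν) (hc : 0 < c)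
    (h : ENNReal.ofReal c ≤ G.nashC₁Closed ν) (y : V) {t : ℝ} (ht : 0 < t) :
    G.finKernel Finset.univ y y t - 1 / ∑ v, G.vmeas v ≤
      (ν / 2) ^ (ν / 2) * c ^ (-ν) * t ^ (-(ν / 2)) := by
  have : Nonempty V := ⟨y⟩
  set M := ∑ v, G.vmeas v
  have hM : 0 < M := sum_vmeas_pos Finset.univ_nonempty
  have h2p : 0 < (2 : ℝ) ^ (-(2 / ν)) := by positivity
  -- The mean-zero Nash inequality supplies the factor `2^{-2/ν}` itself, so it is applied with `c`
  -- divided by it.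
  have hc' : 0 < c / (2 : ℝ) ^ (-(2 / ν)) := by positivity
  have h' : ENNReal.ofReal (c / (2 : ℝ) ^ (-(2 / ν))) ≤
      G.isoConstClosed ν * G.rhoSup ^ (-(1 / 2) : ℝ) / 2 := by
    have h2 : (2 : ℝ≥0∞) ^ (-(2 / ν)) = ENNReal.ofReal ((2 : ℝ) ^ (-(2 / ν))) := by
      rw [← ENNReal.ofReal_rpow_of_pos two_pos]; simp
    rw [nashC₁Closed, h2] at h
    rw [ENNReal.ofReal_div_of_pos h2p]
    exact ENNReal.div_le_of_le_mul' h
  obtain ⟨r, hr, hρ, hI⟩ := exists_pos_of_ofReal_le hc' h'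
  have hcc : (2 : ℝ) ^ (-(2 / ν)) * (c / (2 : ℝ) ^ (-(2 / ν))) = c := by field_simp
  have hsum := sum_vmeas_mul_finKernel_univ hG y
  -- Conservation of mass turns the excess of the diagonal over equilibrium into a squared `L²`
  -- norm.
  have hN2 : ∀ s, G.finKernel Finset.univ y y s - 1 / M =
      ∑ v, G.vmeas v * (G.finKernel Finset.univ v y (s / 2) - 1 / M) ^ 2 := fun s => by
    have e : ∑ v, G.vmeas v * (G.finKernel Finset.univ v y (s / 2) - 1 / M) ^ 2 =
        ∑ v, G.vmeas v * G.finKernel Finset.univ v y (s / 2) ^ 2 -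
          2 / M * ∑ v, G.vmeas v * G.finKernel Finset.univ v y (s / 2) + (1 / M) ^ 2 * M := by
      rw [Finset.mul_sum, Finset.mul_sum, ← Finset.sum_sub_distrib, ← Finset.sum_add_distrib]
      exact Finset.sum_congr rfl fun v _ => by ring
    rw [e, hsum, ← finKernel_diag_eq hG]
    field_simp
    ring
  refine le_rpow_of_deriv_le (ψ := fun s => G.finKernel Finset.univ y y s - 1 / M) (by linarith) hc ht
    (fun s _ => (hasDerivAt_finKernel hG (Finset.mem_univ y) y s).sub_const _) (fun s _ => ?_)
    fun s hs => ?_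
  · simp only [hN2]
    exact Finset.sum_nonneg fun v _ => mul_nonneg (G.vmeas_pos v).le (sq_nonneg _)
  · rw [neg_neg, lap_finKernel_diag_eq hG (Finset.mem_univ y)]
    simp only [hN2]
    have hen : energy hG Finset.univ (fun v => G.finKernel Finset.univ v y (s / 2)) =
        energy hG Finset.univ (fun v => G.finKernel Finset.univ v y (s / 2) - 1 / M) := by
      simp only [energy, sub_sub_sub_cancel_right]
    have hMM : ∑ v, G.vmeas v * (1 / M) = 1 := by
      rw [← Finset.sum_mul]
      exact mul_one_div_cancel hM.ne'
    rw [hen, ← hcc]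
    refine nash_inequality_closed hG hb hν hc' hr hρ hI _ ?_ ?_
    · simp_rw [mul_sub]
      rw [Finset.sum_sub_distrib, hsum, hMM, sub_self]
    · have : ∀ v, G.vmeas v * |G.finKernel Finset.univ v y (s / 2) - 1 / M| ≤
          G.vmeas v * G.finKernel Finset.univ v y (s / 2) + G.vmeas v * (1 / M) := fun v => by
        rw [← mul_add]
        refine mul_le_mul_of_nonneg_left ((abs_sub _ _).trans_eq ?_) (G.vmeas_pos v).le
        rw [abs_of_nonneg (finKernel_nonneg hG v y (div_nonneg hs zero_le_two)),
          abs_of_pos (one_div_pos.2 hM)]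
      refine (Finset.sum_le_sum fun v _ => this v).trans_eq ?_
      rw [Finset.sum_add_distrib, hsum, hMM]
      norm_num

include hG in
theorem vKernel_le_finKernel_univ (u v : V) {t : ℝ} (ht : 0 ≤ t) :
    G.vKernel u v t ≤ G.finKernel Finset.univ u v t :=
  ciSup_le fun _ => finKernel_mono hG (Finset.subset_univ _) u v ht

end Closed

end CalcGraph

theorem mainTheorem9 {V : Type u} {E : Type w} (G : CalcGraph V E) (hG : G.IsLocallyFinite) :
    (∃ K, G.IsMinimalHeatKernel K) ∧
    ∀ K, G.IsMinimalHeatKernel K → ∀ ν : ℝ, 2 < ν →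
      (∀ (x : G.Realization) (t : ℝ), 0 < t →
        ENNReal.ofReal (K x x t) ≤
          nashC₂ ν (G.nashC₁ ν) * ENNReal.ofReal t ^ (-(ν / 2))) ∧
      (G.IsClosedGraph → ∀ (x : G.Realization) (t : ℝ), 0 < t →
        ENNReal.ofReal (K x x t - 1 / (G.vol univ).toReal) ≤
          nashC₂ ν (G.nashC₁Closed ν) * ENNReal.ofReal t ^ (-(ν / 2))) := by
  refine ⟨⟨_, CalcGraph.isMinimalHeatKernel_minKernel hG⟩, fun K hK ν hν => ⟨fun x t ht => ?_, ?_⟩⟩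
  · rw [hK.eq_minKernel hG x x ht.le]
    exact ofReal_le_nashC₂_mul (by linarith) ht fun c hc h => CalcGraph.minKernel_diag_le hG ht.le
      (fun v => CalcGraph.vKernel_diag_le hG (by linarith) hc h v ht) x
  · rintro ⟨hV, -, hb⟩ x t ht
    have := Fintype.ofFinite V
    have hvol : (G.vol univ).toReal = ∑ v, G.vmeas v := by
      rw [CalcGraph.vol_eq_ofReal (A := Finset.univ) (by simp), ENNReal.toReal_ofReal
        (Finset.sum_nonneg fun v _ => (G.vmeas_pos v).le)]
    rw [hK.eq_minKernel hG x x ht.le, hvol]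
    refine ofReal_le_nashC₂_mul (by linarith) ht fun c hc h => ?_
    -- The constant `1/𝒱(𝒢)` moves to the right so that the passage from vertices to edges, which
    -- needs a constant upper bound, applies.
    rw [sub_le_iff_le_add]
    refine CalcGraph.minKernel_diag_le hG ht.le (fun v => ?_) x
    rw [← sub_le_iff_le_add]
    exact (sub_le_sub_right (CalcGraph.vKernel_le_finKernel_univ hG v v ht.le) _).trans
      (CalcGraph.finKernel_univ_diag_sub_le hG hb (by linarith) hc h v ht)
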